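/- **Setting.** Let $I=[0,1]$. A *Lasota–Yorke map* is a map $\hat T:I\to I$ with a finite partition $\mathcal Z$ of $I$ into nondegenerate intervals such that $\hat T|_Z$ has a $C^1$ extension to $\bar Z$ for each $Z\in\mathcal Z$, $D\hat T\neq 0$ and $|D\hat T|^{-1}\le\hat\Theta$ for some $\hat\Theta<1$, and $\hat g:=|D\hat T|^{-1}$ has bounded variation (derivatives at endpoints of $Z$ are those of $\hat T|_Z$). A *hole* $H_0\subsetneq I$ is a finite union of closed intervals. Let $\mathcal Z_f$ be the set of *full branches*: those $Z\in\mathcal Z$ with $Z\cap H_0=\emptyset$ and $\hat T(Z)=I$ up to the endpoints $0,1$. The pair $T_0=(\hat T,H_0)$ is a *full-branched map with holes* if every $Z\in\mathcal Z$ is contained in $H_0$ or belongs to $\mathcal Z_f$. For $m\ge0$ put $X_m=\bigcap_{j=0}^m\hat T^{-j}(I\setminus H_0)$, $H_m=I\setminus X_m$ and $T_m=(\hat T,H_m)$. For an open system $T=(\hat T,H)$ with $X=I\setminus H$ let $\mathcal L f(x)=\sum_{\hat T y=x}1_X(y)f(y)\hat g(y)$, $D_n=\{x\in I:\mathcal L^n1(x)\ne0\}$,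 $D_\infty=\bigcap_{n\ge1}D_n$ and $\|DT^{-1}\|_\infty=\sup_X\hat g$. Functions and sets are considered modulo Lebesgue-null sets, so infima over $D_n$ and over $x\in I$ below are essential infima, and $D_\infty\neq\emptyset$ means that $D_\infty$ is not a null set. Let $$\rho(T)=\lim_{n\to\infty}\inf_{D_n}\frac{\mathcal L^{n+1}1}{\mathcal L^n1}.$$ For $\epsilon>0$, a finite partition $P$ of $I$ into nondegenerate intervals is *$\epsilon$-adequate* for $T$ if for all $A\in P$ the interior of $A$ is contained in or disjoint from $X$, and $\operatorname{var}_A(1_X\hat g)<\|DT^{-1}\|_\infty(1+\epsilon)$. Let $P^*$ be the set of $A\in P$ with interior contained in $X$; such an $A$ is *good* if $\lim_n\inf_{D_n}\mathcal L^n1_A/\mathcal L^n1$ exists and is positive, and *bad* otherwise. Let $\xi_\epsilon(T)$ be the infimum over $\epsilon$-adequate $P$ of the maximal number of bad elements that are consecutive in $P^*$, let $\alpha_\epsilon(T)=\|DT^{-1}\|_\infty(2+\epsilon+\xi_\epsilon(T))$, and call $H$ *$\epsilon$-Ulam-admissible* for $\hat T$ if $D_\infty\ne\emptyset$ and $\alpha_\epsilon(T)<\rho(T)$.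 **Computability.** A *description* of $(T_0,\epsilon)$ is a sequence $p:\mathbb N\to\mathbb N$ with $2^{-p(0)}\le\epsilon$, with $\hat g\le1-\frac1{p(1)+1}$ and $|D\hat T|\le p(2)$ on all full branches, and with $\operatorname{var}_{[a,b]}\hat g\le2^{-k}$ for all $k\in\mathbb N$ whenever $a\le b$ lie in a common full branch and $b-a\le2^{-p(k+3)}$. An algorithm computes a number from $p$ if it reads $p(0),p(1),\dots$ successively and after finitely many steps stops with that number. **Statement.** There is one algorithm such that for every full-branched map with holes $T_0=(\hat T,H_0)$ and every $\epsilon>0$: descriptions of $(T_0,\epsilon)$ exist, and from each of them the algorithm computes some $m\in\mathbb N$ such that 1. $\xi_\epsilon(T_m)=0$; 2. the limits defining $\rho(T_m)$ and $\rho(T_0)$ exist and $$\rho(T_m)=\rho(T_0)\ \ge\ \rho_0:=\inf_{x\in I}\ \sum_{y\in Z\in\mathcal Z_f,\ \hat T(y)=x}\frac1{|D\hat T(y)|};$$ 3. $\displaystyle\alpha_\epsilon(T_m)\ \le\ \alpha_{\epsilon,0}:=(2+\epsilon)\sup_{x\in Z\in\mathcal Z_f}\frac1{|D\hat T(x)|};$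 4. if $\rho_0>\alpha_{\epsilon,0}$, then $H_m$ is $\epsilon$-Ulam-admissible for $\hat T$. -/

import Mathlib

open Set Filter Topology MeasureTheory

namespace OpenLY

noncomputable section

/-- A finite partition of `I = [0,1]` into pairwise disjoint nondegenerate intervals (each of them
open, closed or half-open). -/
structure IsIntervalPartition (P : Finset (Set ℝ)) : Prop where
  ordConnected : ∀ A ∈ P, A.OrdConnected
  nondegenerate : ∀ A ∈ P, (interior A).Nonempty
  disjoint : (P : Set (Set ℝ)).PairwiseDisjoint id
  cover : (⋃ A ∈ P, A) = Icc (0 : ℝ) 1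

/-- The derivative of the piecewise `C¹` map `T` at `x`: the derivative at `x` of the restriction of
`T` to the element of the monotonicity partition `Z` that contains `x` (so it is one-sided when `x`
is an endpoint of that element). -/
def branchDeriv (T : ℝ → ℝ) (Z : Finset (Set ℝ)) (x : ℝ) : ℝ :=
  derivWithin T {y | ∃ A ∈ Z, x ∈ A ∧ y ∈ A} x

/-- The weight `ĝ = 1 / |DT|`. -/
def weight (T : ℝ → ℝ) (Z : Finset (Set ℝ)) (x : ℝ) : ℝ := |branchDeriv T Z x|⁻¹

/-- `T : [0,1] → [0,1]` is a Lasota-Yorke map with finite monotonicity partition `Z`. -/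
structure IsLasotaYorke (T : ℝ → ℝ) (Z : Finset (Set ℝ)) : Prop where
  mapsTo : MapsTo T (Icc 0 1) (Icc 0 1)
  partition : IsIntervalPartition Z
  /-- each branch has a `C¹` extension to the closure of its interval -/
  contDiff : ∀ A ∈ Z, ∃ F : ℝ → ℝ, ContDiffOn ℝ 1 F (closure A) ∧ EqOn T F A
  /-- uniform expansion -/
  expanding : ∃ Θ : ℝ, Θ < 1 ∧ ∀ x ∈ Icc (0 : ℝ) 1, branchDeriv T Z x ≠ 0 ∧ weight T Z x ≤ Θ
  /-- `1 / |DT|` has bounded variation -/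
  boundedVariation : BoundedVariationOn (weight T Z) (Icc 0 1)

/-- A hole: a finite union of closed intervals which is a proper subset of `[0,1]`. -/
def IsHole (H : Set ℝ) : Prop :=
  (∃ F : Finset (ℝ × ℝ), H = ⋃ q ∈ F, Icc q.1 q.2) ∧ H ⊂ Icc (0 : ℝ) 1

/-- `X_m`, the points of `[0,1]` whose first `m` iterates (and the point itself) avoid the hole. -/
def survivors (T : ℝ → ℝ) (H : Set ℝ) (m : ℕ) : Set ℝ :=
  {x | x ∈ Icc (0 : ℝ) 1 ∧ ∀ j ≤ m, T^[j] x ∉ H}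

/-- The enlarged hole `H_m = I \ X_m`. -/
def enlargedHole (T : ℝ → ℝ) (H : Set ℝ) (m : ℕ) : Set ℝ := Icc (0 : ℝ) 1 \ survivors T H m

/-! ### The open system `(T, H)` for a subset `H` of `[0,1]` -/

/-- The domain `X = I \ H` of the open system. -/
def domain (H : Set ℝ) : Set ℝ := Icc (0 : ℝ) 1 \ H

/-- The transfer operator of the closed map, `f ↦ (x ↦ ∑_{T y = x} f y / |DT y|)`. -/
def closedTransfer (T : ℝ → ℝ) (Z : Finset (Set ℝ)) (f : ℝ → ℝ) (x : ℝ) : ℝ :=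
  ∑ᶠ y ∈ {y | y ∈ Icc (0 : ℝ) 1 ∧ T y = x}, f y * weight T Z y

/-- The transfer operator of the open system, `L f = L̂ (1_X f)`. -/
def transfer (T : ℝ → ℝ) (Z : Finset (Set ℝ)) (H : Set ℝ) (f : ℝ → ℝ) : ℝ → ℝ :=
  closedTransfer T Z ((domain H).indicator f)

/-- `L^n f`. -/
def transferIter (T : ℝ → ℝ) (Z : Finset (Set ℝ)) (H : Set ℝ) (n : ℕ) (f : ℝ → ℝ) : ℝ → ℝ :=
  (transfer T Z H)^[n] f

/-- `D_n = {x ∈ I : L^n 1 (x) ≠ 0}`. -/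
def supportSet (T : ℝ → ℝ) (Z : Finset (Set ℝ)) (H : Set ℝ) (n : ℕ) : Set ℝ :=
  {x | x ∈ Icc (0 : ℝ) 1 ∧ transferIter T Z H n 1 x ≠ 0}

/-- `D_∞ = ⋂_{n ≥ 1} D_n`. -/
def supportInfty (T : ℝ → ℝ) (Z : Finset (Set ℝ)) (H : Set ℝ) : Set ℝ :=
  ⋂ n ≥ 1, supportSet T Z H n

/-- `inf_{x ∈ D_n} f x / L^n 1 (x)`. As usual for transfer operators on functions of bounded
variation, functions are identified when they agree Lebesgue almost everywhere, so the infimum is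
the essential infimum with respect to Lebesgue measure on `D_n`. -/
def infRatio (T : ℝ → ℝ) (Z : Finset (Set ℝ)) (H : Set ℝ) (n : ℕ) (f : ℝ → ℝ) : ℝ :=
  essInf (fun x => f x / transferIter T Z H n 1 x) (volume.restrict (supportSet T Z H n))

/-- `ρ(T, H) = lim_n inf_{D_n} L^{n+1} 1 / L^n 1` exists and equals `ρ`. -/
def IsEscapeRate (T : ℝ → ℝ) (Z : Finset (Set ℝ)) (H : Set ℝ) (ρ : ℝ) : Prop :=
  Tendsto (fun n => infRatio T Z H n (transferIter T Z H (n + 1) 1)) atTop (𝓝 ρ)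

/-- `‖DT⁻¹‖_∞` for the open system: the supremum of `1 / |DT|` over its domain. (`1 / |DT|` is
continuous on each branch, so for domains without isolated points it is also the essential
supremum.) -/
def invDerivNorm (T : ℝ → ℝ) (Z : Finset (Set ℝ)) (H : Set ℝ) : ℝ :=
  sSup (weight T Z '' domain H)

/-- `P` is an `ε`-adequate partition for the open system. -/
structure IsAdequate (T : ℝ → ℝ) (Z : Finset (Set ℝ)) (H : Set ℝ) (ε : ℝ)
    (P : Finset (Set ℝ)) : Prop where
  partition : IsIntervalPartition P
  interior_cond : ∀ A ∈ P, Disjoint (interior A) (domain H) ∨ interior A ⊆ domain H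
  variation : ∀ A ∈ P, eVariationOn ((domain H).indicator (weight T Z)) A <
    ENNReal.ofReal (invDerivNorm T Z H * (1 + ε))

/-- A set `A` is good if `lim_n inf_{D_n} L^n 1_A / L^n 1` is positive. -/
def IsGood (T : ℝ → ℝ) (Z : Finset (Set ℝ)) (H : Set ℝ) (A : Set ℝ) : Prop :=
  ∃ c : ℝ, 0 < c ∧
    Tendsto (fun n => infRatio T Z H n (transferIter T Z H n (A.indicator 1))) atTop (𝓝 c)

/-- The elements of `P` whose interior is contained in the domain of the open system. -/
def starred (H : Set ℝ) (P : Finset (Set ℝ)) : Set (Set ℝ) :=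
  {A | A ∈ P ∧ interior A ⊆ domain H}

/-- The bad elements of `P`. -/
def badElements (T : ℝ → ℝ) (Z : Finset (Set ℝ)) (H : Set ℝ) (P : Finset (Set ℝ)) :
    Set (Set ℝ) :=
  {A | A ∈ starred H P ∧ ¬ IsGood T Z H A}

/-- `A` lies to the left of `B`. -/
def LeftOf (A B : Set ℝ) : Prop := ∀ a ∈ A, ∀ b ∈ B, a < b

/-- `S` is a collection of contiguous bad elements of `P`: every starred element of `P` lying
between two members of `S` belongs to `S`. (Elements of `P` inside the hole do not interrupt.) -/
def IsBadRun (T : ℝ → ℝ) (Z : Finset (Set ℝ)) (H : Set ℝ) (P S : Finset (Set ℝ)) : Prop :=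
  (∀ A ∈ S, A ∈ badElements T Z H P) ∧
    ∀ A ∈ S, ∀ C ∈ S, ∀ B ∈ starred H P, LeftOf A B → LeftOf B C → B ∈ S

/-- `ξ_ε`: the infimum over `ε`-adequate partitions of the maximal number of contiguous bad
elements. It is `⊤` if there is no `ε`-adequate partition. -/
def xi (T : ℝ → ℝ) (Z : Finset (Set ℝ)) (H : Set ℝ) (ε : ℝ) : ℕ∞ :=
  ⨅ P ∈ {P : Finset (Set ℝ) | IsAdequate T Z H ε P},
    ⨆ S ∈ {S : Finset (Set ℝ) | IsBadRun T Z H P S}, (S.card : ℕ∞)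

/-- `α_ε = ‖DT⁻¹‖_∞ (2 + ε + ξ_ε)`. -/
def alpha (T : ℝ → ℝ) (Z : Finset (Set ℝ)) (H : Set ℝ) (ε : ℝ) : ENNReal :=
  ENNReal.ofReal (invDerivNorm T Z H) * (2 + ENNReal.ofReal ε + (xi T Z H ε : ENNReal))

/-- `H` is an `ε`-Ulam-admissible hole for `T`: `D_∞ ≠ ∅` (not even modulo Lebesgue null sets) and
`α_ε < ρ`. -/
def IsUlamAdmissible (T : ℝ → ℝ) (Z : Finset (Set ℝ)) (H : Set ℝ) (ε : ℝ) : Prop :=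
  volume (supportInfty T Z H) ≠ 0 ∧
    ∃ ρ : ℝ, IsEscapeRate T Z H ρ ∧ alpha T Z H ε < ENNReal.ofReal ρ

/-! ### Full-branched maps with holes -/

/-- `Z_h`: the elements of the monotonicity partition contained in the hole. -/
def holeBranches (Z : Finset (Set ℝ)) (H : Set ℝ) : Set (Set ℝ) := {A | A ∈ Z ∧ A ⊆ H}

/-- `Z_f`: the elements of the monotonicity partition that are disjoint from the hole and are mapped
onto `[0,1]`. The elements are pairwise disjoint, hence usually not closed, so that "onto" is
understood up to the two endpoints of `[0,1]`. -/
def fullBranches (T : ℝ → ℝ) (Z : Finset (Set ℝ)) (H : Set ℝ) : Set (Set ℝ) :=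
  {A | A ∈ Z ∧ Disjoint A H ∧ Ioo (0 : ℝ) 1 ⊆ T '' A}

/-- `Z_u`: the remaining elements. -/
def otherBranches (T : ℝ → ℝ) (Z : Finset (Set ℝ)) (H : Set ℝ) : Set (Set ℝ) :=
  {A | A ∈ Z ∧ A ∉ holeBranches Z H ∪ fullBranches T Z H}

/-- `(T, H)` is a full-branched map with holes. -/
structure IsFullBranched (T : ℝ → ℝ) (Z : Finset (Set ℝ)) (H : Set ℝ) : Prop where
  lasotaYorke : IsLasotaYorke T Z
  hole : IsHole H
  full : otherBranches T Z H = ∅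

/-- `ρ₀ = inf_{x ∈ I} ∑ 1 / |DT y|`, the sum being over the preimages `y` of `x` in full branches.
The infimum is essential, so that null sets of `x` are disregarded; it is at least the pointwise
infimum. -/
def rhoBound (T : ℝ → ℝ) (Z : Finset (Set ℝ)) (H : Set ℝ) : ℝ :=
  essInf (fun x => ∑ᶠ y ∈ {y | (∃ A ∈ fullBranches T Z H, y ∈ A) ∧ T y = x}, weight T Z y)
    (volume.restrict (Icc 0 1))

/-- `α_{ε,0} = (sup over full branches of 1 / |DT|) (2 + ε)`. -/
def alphaBound (T : ℝ → ℝ) (Z : Finset (Set ℝ)) (H : Set ℝ) (ε : ℝ) : ℝ :=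
  sSup (weight T Z '' (⋃ A ∈ fullBranches T Z H, A)) * (2 + ε)

/-! ### Computing a natural number from a description of the system -/

/-- The sequence `p` of natural numbers describes `(T, H)` and `ε` quantitatively:
`p 0` gives a positive lower bound for `ε`, `p 1` a bound smaller than one for `1 / |DT|` on the full
branches, `p 2` an upper bound for `|DT|` there, and `k ↦ p (k + 3)` is a modulus of continuity for
the variation of `1 / |DT|` along each full branch. No other information about the system is given,
so an algorithm that works from `p` works from any richer description that lets one compute `p`. -/
structure IsDescription (T : ℝ → ℝ) (Z : Finset (Set ℝ)) (H : Set ℝ) (ε : ℝ) (p : ℕ → ℕ) :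
    Prop where
  eps : (1 / 2 : ℝ) ^ p 0 ≤ ε
  contraction : ∀ A ∈ fullBranches T Z H, ∀ x ∈ A, weight T Z x ≤ 1 - 1 / ((p 1 : ℝ) + 1)
  derivBound : ∀ A ∈ fullBranches T Z H, ∀ x ∈ A, |branchDeriv T Z x| ≤ (p 2 : ℝ)
  modulus : ∀ k : ℕ, ∀ A ∈ fullBranches T Z H, ∀ a ∈ A, ∀ b ∈ A, a ≤ b →
    b - a ≤ (1 / 2 : ℝ) ^ p (k + 3) →
    eVariationOn (weight T Z) (Icc a b) ≤ ENNReal.ofReal ((1 / 2 : ℝ) ^ k)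

/-- The procedure `Φ` reads longer and longer initial segments `p 0, …, p (n - 1)` of the infinite
sequence `p` until it answers for the first time, and its answer is `m`. -/
def Outputs (Φ : List ℕ → Option ℕ) (p : ℕ → ℕ) (m : ℕ) : Prop :=
  ∃ n : ℕ, Φ ((List.range n).map p) = some m ∧ ∀ k < n, Φ ((List.range k).map p) = none

end

end OpenLY

/-! The weighted sum defining the transfer operator is positive, and enlarging the hole only inserts
cutoffs: for `n ≥ 1` the operator of the `m`-th hole satisfies `L_m^n f = 1_{avoiding m} · L^n f`,
where `L` belongs to the original hole (`transferIter_enlargedHole`). Because each full branch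
covers the unit interval with bounded derivative, `L^n 1` is bounded below by a positive constant
a.e., so the supports for the enlarged holes are the sets `avoiding m`, which are not null.

A surviving cylinder `B` of order `m` is a composition of `m + 1` full branches, so `L^{m+1} 1_B` is
bounded below as well and `B` is good (`isGood_cylinder`). Hence the cylinder partition has no bad
elements, and `xi` vanishes as soon as this partition is adequate. Adequacy is a matter of size:
cylinders shrink geometrically and the weight has uniformly small variation on short intervals. The
description makes both effects quantitative, which yields an explicit computable `m`
(`isAdequate_cylinderPartition`).

Positivity also makes the ratios `r_n = inf L^{n+1} 1 / L^n 1` nondecreasing in `n`, so the limit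
exists and dominates `r_0 = rhoBound`. The cutoff formula gives `r_n(H) ≤ r_n(H_m) ≤ r_{n+m}(H)` for
`n ≥ 1`, so both systems have the same escape rate (`isEscapeRate_enlargedHole`). -/

namespace OpenLY

/-! ### Uniform smallness of variation on short intervals. -/

/-- A continuous function of bounded variation on a bounded interval has small variation on short
subintervals. -/
theorem exists_modulus_of_variation {w : ℝ → ℝ} {A : Set ℝ} (hA : A.OrdConnected)
    (hAI : A ⊆ Icc 0 1) (hw : BoundedVariationOn w A) (hc : ContinuousOn w A) {η : ENNReal}
    (hη : 0 < η) :
    ∃ δ : ℝ, 0 < δ ∧ ∀ a ∈ A, ∀ b ∈ A, a ≤ b → b - a < δ → eVariationOn w (Icc a b) ≤ η := by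
  -- Since `A` need not be closed, the compactness argument runs on all of `[0,1]`. At a point of
  -- `A`, continuity makes the variation on either side small, and the two halves add up. At a point
  -- outside `A`, two points of `A` must lie on the same side, where a half-open interval suffices
  -- and continuity is not needed.
  have local_small : ∀ x : ℝ, ∃ U : Set ℝ, IsOpen U ∧ x ∈ U ∧ ∀ a ∈ A, ∀ b ∈ A, a ∈ U → b ∈ U →
      a ≤ b → eVariationOn w (A ∩ Icc a b) ≤ η := by
    intro x
    by_cases hx : x ∈ A
    · have hl := hw.tendsto_eVariationOn_Icc_zero_left ((hc x hx).mono inter_subset_left)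
      have hr := hw.tendsto_eVariationOn_Icc_zero_right x ((hc x hx).mono inter_subset_left)
      have hη2 : 0 < η / 2 := ENNReal.half_pos hη.ne'
      have := (hl.eventually_le_const hη2).and (hr.eventually_le_const hη2)
      obtain ⟨U, hU, hxU, hUA⟩ := mem_nhdsWithin.1 this
      refine ⟨U, hU, hxU, fun a ha b hb haU hbU hab => ?_⟩
      have h1 := (hUA ⟨haU, ha⟩).1
      have h2 := (hUA ⟨hbU, hb⟩).2
      rcases le_total x a with h | h
      · exact (eVariationOn.mono w (by gcongr)).trans (h2.trans ENNReal.half_le_self)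
      rcases le_total b x with h' | h'
      · exact (eVariationOn.mono w (by gcongr)).trans (h1.trans ENNReal.half_le_self)
      rw [← eVariationOn.Icc_add_Icc w h h' hx]
      exact (add_le_add h1 h2).trans (ENNReal.add_halves η).le
    · have := ((hw.tendsto_eVariationOn_Ico_zero x).eventually_le_const hη).and
        ((hw.tendsto_eVariationOn_Ioc_zero x).eventually_le_const hη)
      obtain ⟨U, hU, hxU, hUA⟩ := mem_nhdsWithin.1 this
      refine ⟨U, hU, hxU, fun a ha b hb haU hbU hab => ?_⟩
      have h1 := (hUA ⟨haU, ha⟩).1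
      have h2 := (hUA ⟨hbU, hb⟩).2
      rcases lt_or_ge x a with h | h
      · have hs : A ∩ Icc a b ⊆ A ∩ Ioc x b := fun y hy => ⟨hy.1, h.trans_le hy.2.1, hy.2.2⟩
        exact (eVariationOn.mono w hs).trans h2
      rcases lt_or_ge b x with h' | h'
      · have hs : A ∩ Icc a b ⊆ A ∩ Ico a x := fun y hy => ⟨hy.1, hy.2.1, hy.2.2.trans_lt h'⟩
        exact (eVariationOn.mono w hs).trans h1
      exact absurd (hA.out ha hb ⟨h, h'⟩) hx
  choose U hU hxU hUA using local_small
  obtain ⟨δ, hδ, hball⟩ := lebesgue_number_lemma_of_metric (isCompact_Icc (a := (0 : ℝ)) (b := 1))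
    hU (fun x _ => mem_iUnion.2 ⟨x, hxU x⟩)
  refine ⟨δ, hδ, fun a ha b hb hab hlt => ?_⟩
  obtain ⟨i, hi⟩ := hball a (hAI ha)
  have := hUA i a ha b hb (hi (Metric.mem_ball_self hδ))
    (hi (by rw [Metric.mem_ball, Real.dist_eq, abs_of_nonneg (by linarith)]; exact hlt)) hab
  rwa [inter_eq_right.2 (hA.out ha hb)] at this

/-- Each variation sum uses finitely many points, all between its first and last one. This passes
from compact subintervals to cylinders, which may lack endpoints. -/
theorem eVariationOn_le_of_forall_Icc {w : ℝ → ℝ} {s : Set ℝ} {η : ENNReal}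
    (h : ∀ a ∈ s, ∀ b ∈ s, a ≤ b → eVariationOn w (Icc a b) ≤ η) : eVariationOn w s ≤ η := by
  refine iSup_le fun p => ?_
  obtain ⟨n, u, hu, hus⟩ := p
  refine (eVariationOn.sum_le_of_monotoneOn_Iic (s := Icc (u 0) (u n)) (hu.monotoneOn _)
    fun i hi => ⟨hu (Nat.zero_le i), hu hi⟩).trans (h _ (hus 0) _ (hus n) (hu (Nat.zero_le n)))

/-! ### Geometry of a single branch. -/

variable {T : ℝ → ℝ} {Z : Finset (Set ℝ)}

theorem weight_nonneg (x : ℝ) : 0 ≤ weight T Z x := inv_nonneg.2 (abs_nonneg _)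

namespace IsIntervalPartition

theorem subset_Icc {P : Finset (Set ℝ)} (h : IsIntervalPartition P) {A : Set ℝ} (hA : A ∈ P) :
    A ⊆ Icc 0 1 := h.cover ▸ subset_biUnion_of_mem (u := fun A : Set ℝ => A) hA

theorem eq_of_mem {P : Finset (Set ℝ)} (h : IsIntervalPartition P) {A B : Set ℝ} (hA : A ∈ P)
    (hB : B ∈ P) {x : ℝ} (hxA : x ∈ A) (hxB : x ∈ B) : A = B :=
  h.disjoint.elim_set hA hB x hxA hxB

theorem exists_mem {P : Finset (Set ℝ)} (h : IsIntervalPartition P) {x : ℝ}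
    (hx : x ∈ Icc (0 : ℝ) 1) : ∃ A ∈ P, x ∈ A := by
  rw [← h.cover] at hx
  simpa using hx

end IsIntervalPartition

namespace IsLasotaYorke

theorem uniqueDiffOn (h : IsLasotaYorke T Z) {A : Set ℝ} (hA : A ∈ Z) : UniqueDiffOn ℝ A :=
  uniqueDiffOn_convex (h.partition.ordConnected A hA).convex (h.partition.nondegenerate A hA)

theorem branchDeriv_eq (h : IsLasotaYorke T Z) {A : Set ℝ} (hA : A ∈ Z) {x : ℝ} (hx : x ∈ A) :
    branchDeriv T Z x = derivWithin T A x := by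
  have : {y | ∃ B ∈ Z, x ∈ B ∧ y ∈ B} = A := by
    ext y
    refine ⟨?_, fun hy => ⟨A, hA, hx, hy⟩⟩
    rintro ⟨B, hB, hxB, hy⟩
    rwa [h.partition.eq_of_mem hA hB hx hxB]
  rw [branchDeriv, this]

theorem contDiffOn (h : IsLasotaYorke T Z) {A : Set ℝ} (hA : A ∈ Z) : ContDiffOn ℝ 1 T A := by
  obtain ⟨F, hF, hTF⟩ := h.contDiff A hA
  exact (hF.mono subset_closure).congr hTF

theorem weight_continuousOn (h : IsLasotaYorke T Z) {A : Set ℝ} (hA : A ∈ Z) :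
    ContinuousOn (weight T Z) A := by
  have hc : ContinuousOn (branchDeriv T Z) A :=
    ((h.contDiffOn hA).continuousOn_derivWithin (h.uniqueDiffOn hA) le_rfl).congr
      fun x hx => h.branchDeriv_eq hA hx
  obtain ⟨Θ, -, hΘ⟩ := h.expanding
  exact hc.abs.inv₀ fun x hx => abs_ne_zero.2 (hΘ x (h.partition.subset_Icc hA hx)).1

theorem weight_pos (h : IsLasotaYorke T Z) {x : ℝ} (hx : x ∈ Icc (0 : ℝ) 1) :
    0 < weight T Z x := by
  obtain ⟨Θ, -, hΘ⟩ := h.expanding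
  exact inv_pos.2 (abs_pos.2 (hΘ x hx).1)

theorem weight_le_one (h : IsLasotaYorke T Z) {x : ℝ} (hx : x ∈ Icc (0 : ℝ) 1) :
    weight T Z x ≤ 1 := by
  obtain ⟨Θ, h1, hΘ⟩ := h.expanding
  exact (hΘ x hx).2.trans h1.le

/-- The `C¹` extension has a continuous, hence bounded, derivative on the compact closure, and on
`A` it coincides with the branch derivative. -/
theorem exists_branchDeriv_le (h : IsLasotaYorke T Z) {A : Set ℝ} (hA : A ∈ Z) :
    ∃ M : ℝ, ∀ x ∈ A, |branchDeriv T Z x| ≤ M := by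
  obtain ⟨F, hF, hTF⟩ := h.contDiff A hA
  have hconv := (h.partition.ordConnected A hA).convex (𝕜 := ℝ)
  have hu : UniqueDiffOn ℝ (closure A) := uniqueDiffOn_convex hconv.closure
    ((h.partition.nondegenerate A hA).mono (interior_mono subset_closure))
  have hcomp : IsCompact (closure A) :=
    isCompact_Icc.of_isClosed_subset isClosed_closure
      (closure_minimal (h.partition.subset_Icc hA) isClosed_Icc)
  obtain ⟨M, hM⟩ := hcomp.exists_bound_of_continuousOn (hF.continuousOn_derivWithin hu le_rfl)
  refine ⟨M, fun x hx => ?_⟩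
  have hxc := subset_closure hx
  have hd : HasDerivWithinAt T (derivWithin F (closure A) x) A x :=
    (((hF.differentiableOn one_ne_zero) x hxc).hasDerivWithinAt.mono subset_closure).congr hTF
      (hTF hx)
  rw [h.branchDeriv_eq hA hx, hd.derivWithin (h.uniqueDiffOn hA x hx)]
  exact hM x hxc

/-- The mean value theorem on a branch. -/
theorem exists_weight_mul_eq (h : IsLasotaYorke T Z) {A : Set ℝ} (hA : A ∈ Z) {a b : ℝ}
    (ha : a ∈ A) (hb : b ∈ A) (hab : a < b) : ∃ c ∈ A, b - a = weight T Z c * |T b - T a| := by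
  have hsub : Icc a b ⊆ A := (h.partition.ordConnected A hA).out ha hb
  have hd := (h.contDiffOn hA).differentiableOn one_ne_zero
  have hnhds : ∀ x ∈ Ioo a b, A ∈ 𝓝 x := fun x hx =>
    mem_of_superset (Icc_mem_nhds hx.1 hx.2) hsub
  obtain ⟨c, hc, hs⟩ := exists_deriv_eq_slope T hab ((hd.continuousOn).mono hsub)
    fun x hx => ((hd x (hsub (Ioo_subset_Icc_self hx))).differentiableAt
      (hnhds x hx)).differentiableWithinAt
  have hcA := hsub (Ioo_subset_Icc_self hc)
  refine ⟨c, hcA, ?_⟩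
  have hne := (h.weight_pos (h.partition.subset_Icc hA hcA)).ne'
  rw [← derivWithin_of_mem_nhds (hnhds c hc), ← h.branchDeriv_eq hA hcA] at hs
  have hba : 0 < b - a := sub_pos.2 hab
  have habs : |T b - T a| = |branchDeriv T Z c| * (b - a) := by
    rw [hs, abs_div, abs_of_pos hba, div_mul_cancel₀ _ hba.ne']
  have : |branchDeriv T Z c| ≠ 0 := fun h0 => hne (by rw [weight, h0, inv_zero])
  rw [habs, weight, inv_mul_cancel_left₀ this]

theorem injOn (h : IsLasotaYorke T Z) {A : Set ℝ} (hA : A ∈ Z) : InjOn T A := by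
  have : ∀ a ∈ A, ∀ b ∈ A, a < b → T a ≠ T b := fun a ha b hb hab he => by
    obtain ⟨c, -, hc⟩ := h.exists_weight_mul_eq hA ha hb hab
    rw [he, sub_self, abs_zero, mul_zero] at hc
    linarith
  intro a ha b hb he
  rcases lt_trichotomy a b with hab | hab | hab
  · exact absurd he (this a ha b hb hab)
  · exact hab
  · exact absurd he.symm (this b hb a ha hab)

theorem continuousOn (h : IsLasotaYorke T Z) {A : Set ℝ} (hA : A ∈ Z) : ContinuousOn T A :=
  (h.contDiffOn hA).continuousOn

theorem ordConnected_inter_preimage (h : IsLasotaYorke T Z) {A B : Set ℝ} (hA : A ∈ Z)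
    (hB : B.OrdConnected) : (A ∩ T ⁻¹' B).OrdConnected := by
  refine ⟨fun x hx z hz y hy => ?_⟩
  have hsub : Icc x z ⊆ A := (h.partition.ordConnected A hA).out hx.1 hz.1
  have hxz := hy.1.trans hy.2
  refine ⟨hsub hy, ?_⟩
  rcases ((h.continuousOn hA).mono hsub).strictMonoOn_of_injOn_Icc' hxz ((h.injOn hA).mono hsub)
    with hm | hm
  · exact hB.out hx.2 hz.2 ⟨hm.monotoneOn (left_mem_Icc.2 hxz) hy hy.1,
      hm.monotoneOn hy (right_mem_Icc.2 hxz) hy.2⟩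
  · exact hB.out hz.2 hx.2 ⟨hm.antitoneOn hy (right_mem_Icc.2 hxz) hy.2,
      hm.antitoneOn (left_mem_Icc.2 hxz) hy hy.1⟩

theorem interior_inter_preimage_nonempty (h : IsLasotaYorke T Z) {A B : Set ℝ} (hA : A ∈ Z)
    (hfull : Ioo (0 : ℝ) 1 ⊆ T '' A) (hB : (interior B).Nonempty) (hBI : B ⊆ Icc 0 1) :
    (interior (A ∩ T ⁻¹' B)).Nonempty := by
  obtain ⟨y, hy⟩ := hB
  have hy' : y ∈ Ioo (0 : ℝ) 1 := interior_Icc (a := (0 : ℝ)) (b := 1) ▸ interior_mono hBI hy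
  obtain ⟨x, hx, rfl⟩ := hfull hy'
  obtain ⟨U, hU, hUA⟩ := (continuousOn_iff'.1 (h.continuousOn hA)) _ (isOpen_interior (s := B))
  have hxU : x ∈ U := ((Set.ext_iff.1 hUA x).1 ⟨hy, hx⟩).1
  -- The preimage `x` may be an endpoint of `A`; a nearby interior point of `A` still maps into the
  -- interior of `B`.
  have hcl : x ∈ closure (interior A) := by
    rw [((h.partition.ordConnected A hA).convex (𝕜 := ℝ)).closure_interior_eq_closure_of_nonempty_interior
      (h.partition.nondegenerate A hA)]
    exact subset_closure hx
  obtain ⟨z, hzU, hzA⟩ := mem_closure_iff.1 hcl U hU hxU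
  refine ⟨z, mem_interior.2 ⟨U ∩ interior A, fun v hv => ?_, hU.inter isOpen_interior, hzU, hzA⟩⟩
  have hvA := interior_subset hv.2
  have hvB : T v ∈ interior B := ((Set.ext_iff.1 hUA v).2 ⟨hv.1, hvA⟩).1
  exact ⟨hvA, (interior_subset hvB : T v ∈ B)⟩

theorem finite_fiber (h : IsLasotaYorke T Z) (x : ℝ) :
    {y | y ∈ Icc (0 : ℝ) 1 ∧ T y = x}.Finite := by
  refine (Z.finite_toSet.biUnion (t := fun A => {y | y ∈ A ∧ T y = x}) fun A hA => ?_).subset ?_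
  · exact Set.Subsingleton.finite fun a ha b hb => h.injOn hA ha.1 hb.1 (ha.2.trans hb.2.symm)
  · rintro y ⟨hy, hyx⟩
    obtain ⟨A, hA, hyA⟩ := h.partition.exists_mem hy
    exact mem_biUnion hA ⟨hyA, hyx⟩

/-- Differentiable maps of the line preserve null sets. This is what lets the transfer operator act
on functions modulo null sets. -/
theorem volume_image_null (h : IsLasotaYorke T Z) {N : Set ℝ} (hN : volume N = 0) :
    volume (T '' (Icc 0 1 ∩ N)) = 0 := by
  have hsub : T '' (Icc 0 1 ∩ N) ⊆ ⋃ A ∈ Z, T '' (A ∩ N) := by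
    rintro _ ⟨x, ⟨hx, hxN⟩, rfl⟩
    obtain ⟨A, hA, hxA⟩ := h.partition.exists_mem hx
    exact mem_biUnion hA ⟨x, ⟨hxA, hxN⟩, rfl⟩
  refine measure_mono_null hsub ((measure_biUnion_null_iff Z.countable_toSet).2 fun A hA => ?_)
  exact addHaar_image_eq_zero_of_differentiableOn_of_addHaar_eq_zero volume
    (((h.contDiffOn hA).differentiableOn one_ne_zero).mono inter_subset_left)
    (measure_mono_null inter_subset_right hN)

end IsLasotaYorke

/-! ### Transfer operators and the cutoff formula for enlarged holes. -/

/-- Lebesgue measure on the unit interval. -/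
noncomputable abbrev unitVolume : Measure ℝ := volume.restrict (Icc 0 1)

theorem ae_unitVolume_iff {p : ℝ → Prop} :
    (∀ᵐ x ∂unitVolume, p x) ↔ ∀ᵐ x, x ∈ Icc (0 : ℝ) 1 → p x :=
  ae_restrict_iff' measurableSet_Icc

theorem ae_unitVolume_of_Ioo {p : ℝ → Prop} (hp : ∀ x ∈ Ioo (0 : ℝ) 1, p x) :
    ∀ᵐ x ∂unitVolume, p x := by
  rw [unitVolume, ← Measure.restrict_congr_set (Ioo_ae_eq_Icc (μ := volume) (a := (0 : ℝ)) (b := 1)),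
    ae_restrict_iff' measurableSet_Ioo]
  exact Eventually.of_forall hp

/-- The points of `[0,1]` that avoid `H` at the times `0, …, n - 1`. -/
def avoiding (T : ℝ → ℝ) (H : Set ℝ) (n : ℕ) : Set ℝ :=
  {x | x ∈ Icc (0 : ℝ) 1 ∧ ∀ j < n, T^[j] x ∉ H}

/-- `avoiding` counts the times checked, one more than the index of `survivors`. The shift makes
room for `avoiding T H 0`, the whole interval, so that the cutoff formula also covers `m = 0`. -/
theorem domain_enlargedHole (H : Set ℝ) (m : ℕ) :
    domain (enlargedHole T H m) = avoiding T H (m + 1) := by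
  have : survivors T H m = avoiding T H (m + 1) := by
    simp only [survivors, avoiding, Nat.lt_succ_iff]
  rw [domain, enlargedHole, this, sdiff_sdiff_right_self, inter_eq_right.2 fun x hx => hx.1]

theorem avoiding_zero (H : Set ℝ) : avoiding T H 0 = Icc 0 1 := by
  ext x
  simp [avoiding]

theorem avoiding_subset_Icc (H : Set ℝ) (n : ℕ) : avoiding T H n ⊆ Icc 0 1 := fun _ hx => hx.1

theorem avoiding_anti (H : Set ℝ) {m n : ℕ} (hmn : m ≤ n) : avoiding T H n ⊆ avoiding T H m :=
  fun _ hx => ⟨hx.1, fun j hj => hx.2 j (hj.trans_le hmn)⟩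

theorem avoiding_one (H : Set ℝ) : avoiding T H 1 = domain H := by
  ext x
  simp [avoiding, domain]

theorem mem_avoiding_succ (hT : MapsTo T (Icc 0 1) (Icc 0 1)) {H : Set ℝ} {n : ℕ} {x : ℝ} :
    x ∈ avoiding T H (n + 1) ↔ x ∈ domain H ∧ T x ∈ avoiding T H n := by
  constructor
  · rintro ⟨hx, hj⟩
    exact ⟨⟨hx, hj 0 n.succ_pos⟩, hT hx, fun j hjn => hj (j + 1) (Nat.succ_lt_succ hjn)⟩
  · rintro ⟨⟨hx, hxH⟩, -, hj⟩
    refine ⟨hx, fun j hjn => ?_⟩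
    cases j with
    | zero => exact hxH
    | succ j => exact hj j (Nat.lt_of_succ_lt_succ hjn)

theorem transferIter_succ (K : Set ℝ) (n : ℕ) (f : ℝ → ℝ) :
    transferIter T Z K (n + 1) f = transfer T Z K (transferIter T Z K n f) :=
  Function.iterate_succ_apply' _ _ _

theorem transferIter_succ' (K : Set ℝ) (n : ℕ) (f : ℝ → ℝ) :
    transferIter T Z K (n + 1) f = transferIter T Z K n (transfer T Z K f) :=
  Function.iterate_succ_apply _ _ _

theorem transferIter_add (K : Set ℝ) (m n : ℕ) (f : ℝ → ℝ) :
    transferIter T Z K (m + n) f = transferIter T Z K m (transferIter T Z K n f) :=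
  Function.iterate_add_apply _ _ _ _

namespace IsLasotaYorke

theorem transfer_eq_sum (h : IsLasotaYorke T Z) (K : Set ℝ) (f : ℝ → ℝ) (x : ℝ) :
    transfer T Z K f x =
      ∑ y ∈ (h.finite_fiber x).toFinset, (domain K).indicator f y * weight T Z y :=
  finsum_mem_eq_finite_toFinset_sum _ _

/-- Only the fibre over `x` matters. Allowing two different holes reduces every change of hole below
to an identity of indicators. -/
theorem transfer_le_of_fiber (h : IsLasotaYorke T Z) {K K' : Set ℝ} {f g : ℝ → ℝ} {x : ℝ}
    (hfg : ∀ y ∈ Icc (0 : ℝ) 1, T y = x → (domain K).indicator f y ≤ (domain K').indicator g y) :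
    transfer T Z K f x ≤ transfer T Z K' g x := by
  rw [h.transfer_eq_sum, h.transfer_eq_sum]
  refine Finset.sum_le_sum fun y hy => ?_
  obtain ⟨hyI, hyx⟩ := (h.finite_fiber x).mem_toFinset.1 hy
  exact mul_le_mul_of_nonneg_right (hfg y hyI hyx) (weight_nonneg y)

theorem transfer_congr_of_fiber (h : IsLasotaYorke T Z) {K K' : Set ℝ} {f g : ℝ → ℝ} {x : ℝ}
    (hfg : ∀ y ∈ Icc (0 : ℝ) 1, T y = x → (domain K).indicator f y = (domain K').indicator g y) :
    transfer T Z K f x = transfer T Z K' g x :=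
  le_antisymm (h.transfer_le_of_fiber fun y hy hyx => (hfg y hy hyx).le)
    (h.transfer_le_of_fiber fun y hy hyx => (hfg y hy hyx).ge)

theorem transfer_zero (h : IsLasotaYorke T Z) (K : Set ℝ) : transfer T Z K 0 = 0 := by
  ext x
  simp [h.transfer_eq_sum]

theorem transfer_smul (h : IsLasotaYorke T Z) (K : Set ℝ) (c : ℝ) (f : ℝ → ℝ) :
    transfer T Z K (c • f) = c • transfer T Z K f := by
  ext x
  simp only [h.transfer_eq_sum, Pi.smul_apply, smul_eq_mul, Finset.mul_sum]
  refine Finset.sum_congr rfl fun y _ => ?_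
  by_cases hy : y ∈ domain K <;> simp [hy, mul_assoc]

/-- The inequality can fail only at images of exceptional points, and these images form a null set.
-/
theorem transfer_ae_mono (h : IsLasotaYorke T Z) (K : Set ℝ) {f g : ℝ → ℝ}
    (hfg : f ≤ᵐ[unitVolume] g) : transfer T Z K f ≤ᵐ[unitVolume] transfer T Z K g := by
  have hN := ae_iff.1 (ae_unitVolume_iff.1 hfg)
  refine ae_restrict_of_ae (measure_mono_null (fun x hx => ?_) (h.volume_image_null hN))
  by_contra hx'
  refine hx (h.transfer_le_of_fiber fun y hy hyx => ?_)
  by_cases hyK : y ∈ domain K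
  · rw [indicator_of_mem hyK, indicator_of_mem hyK]
    by_contra hlt
    exact hx' ⟨y, ⟨hy, fun hy' => hlt (hy' hy)⟩, hyx⟩
  · simp [hyK]

theorem transferIter_zero_fun (h : IsLasotaYorke T Z) (K : Set ℝ) (n : ℕ) :
    transferIter T Z K n 0 = 0 := by
  induction n with
  | zero => rfl
  | succ n ih => rw [transferIter_succ, ih, h.transfer_zero]

theorem transferIter_smul (h : IsLasotaYorke T Z) (K : Set ℝ) (n : ℕ) (c : ℝ) (f : ℝ → ℝ) :
    transferIter T Z K n (c • f) = c • transferIter T Z K n f := by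
  induction n with
  | zero => rfl
  | succ n ih => rw [transferIter_succ, transferIter_succ, ih, h.transfer_smul]

theorem transferIter_ae_mono (h : IsLasotaYorke T Z) (K : Set ℝ) (n : ℕ) {f g : ℝ → ℝ}
    (hfg : f ≤ᵐ[unitVolume] g) :
    transferIter T Z K n f ≤ᵐ[unitVolume] transferIter T Z K n g := by
  induction n with
  | zero => exact hfg
  | succ n ih =>
    rw [transferIter_succ, transferIter_succ]
    exact h.transfer_ae_mono K ih

theorem transferIter_ae_nonneg (h : IsLasotaYorke T Z) (K : Set ℝ) (n : ℕ) {f : ℝ → ℝ}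
    (hf : 0 ≤ᵐ[unitVolume] f) : 0 ≤ᵐ[unitVolume] transferIter T Z K n f := by
  simpa only [h.transferIter_zero_fun] using h.transferIter_ae_mono K n hf

/-- The transfer operator is bounded by the number of branches. -/
theorem transfer_one_le (h : IsLasotaYorke T Z) (K : Set ℝ) (x : ℝ) :
    transfer T Z K 1 x ≤ Z.card := by
  rw [h.transfer_eq_sum]
  have hterm : ∀ y ∈ (h.finite_fiber x).toFinset,
      (domain K).indicator 1 y * weight T Z y ≤ 1 := fun y hy => by
    obtain ⟨hyI, -⟩ := (h.finite_fiber x).mem_toFinset.1 hy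
    have h1 := h.weight_le_one hyI
    by_cases hyK : y ∈ domain K <;> simp [hyK, h1]
  refine (Finset.sum_le_card_nsmul _ _ 1 hterm).trans ?_
  rw [nsmul_eq_mul, mul_one, Nat.cast_le]
  have hex : ∀ y ∈ (h.finite_fiber x).toFinset, ∃ A ∈ Z, y ∈ A := fun y hy =>
    h.partition.exists_mem ((h.finite_fiber x).mem_toFinset.1 hy).1
  choose! br hbr hmem using hex
  -- Distinct preimages of `x` lie in distinct branches, by injectivity on each branch.
  refine Finset.card_le_card_of_injOn br hbr fun a ha b hb hab => ?_
  have hbA : b ∈ br a := hab ▸ hmem b hb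
  exact h.injOn (hbr a ha) (hmem a ha) hbA
    (((h.finite_fiber x).mem_toFinset.1 ha).2.trans ((h.finite_fiber x).mem_toFinset.1 hb).2.symm)

theorem weight_le_transfer_indicator (h : IsLasotaYorke T Z) {K A : Set ℝ} {y : ℝ}
    (hyA : y ∈ A) (hyK : y ∈ domain K) :
    weight T Z y ≤ transfer T Z K (A.indicator 1) (T y) := by
  rw [h.transfer_eq_sum]
  have hy : y ∈ (h.finite_fiber (T y)).toFinset :=
    (h.finite_fiber (T y)).mem_toFinset.2 ⟨hyK.1, rfl⟩
  have := Finset.single_le_sum (f := fun z => (domain K).indicator (A.indicator 1) z * weight T Z z)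
    (fun z _ => mul_nonneg (indicator_nonneg (fun z _ => indicator_nonneg (by simp) z) z)
      (weight_nonneg z)) hy
  simpa [hyA, hyK] using this

theorem transfer_indicator_preimage (h : IsLasotaYorke T Z) (K S : Set ℝ) (f : ℝ → ℝ) :
    transfer T Z K ((T ⁻¹' S).indicator f) = S.indicator (transfer T Z K f) := by
  ext x
  by_cases hx : x ∈ S
  · rw [indicator_of_mem hx]
    refine h.transfer_congr_of_fiber fun y _ hyx => ?_
    rw [indicator_indicator, inter_comm, ← indicator_indicator,
      indicator_of_mem (show y ∈ T ⁻¹' S by rwa [mem_preimage, hyx])]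
  · rw [indicator_of_notMem hx, h.transfer_eq_sum]
    refine Finset.sum_eq_zero fun y hy => ?_
    obtain ⟨-, hyx⟩ := (h.finite_fiber x).mem_toFinset.1 hy
    have hyS : y ∉ T ⁻¹' S := by rwa [mem_preimage, hyx]
    rw [indicator_indicator, indicator_of_notMem fun hy' => hyS hy'.2, zero_mul]

theorem transfer_enlargedHole (h : IsLasotaYorke T Z) (H : Set ℝ) (m : ℕ) (f : ℝ → ℝ) :
    transfer T Z (enlargedHole T H m) f = (avoiding T H m).indicator (transfer T Z H f) := by
  rw [← h.transfer_indicator_preimage]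
  ext x
  refine h.transfer_congr_of_fiber fun y hy hyx => ?_
  rw [domain_enlargedHole, indicator_indicator]
  congr 1
  ext z
  exact mem_avoiding_succ h.mapsTo

/-- The cutoff to `avoiding T H m` left by one step is absorbed by the stricter cutoff of the next.
The exponent starts at one because the zeroth iterate carries no cutoff. -/
theorem transferIter_enlargedHole (h : IsLasotaYorke T Z) (H : Set ℝ) (m n : ℕ) (f : ℝ → ℝ) :
    transferIter T Z (enlargedHole T H m) (n + 1) f =
      (avoiding T H m).indicator (transferIter T Z H (n + 1) f) := by
  induction n with
  | zero => exact h.transfer_enlargedHole H m f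
  | succ n ih =>
    rw [transferIter_succ, ih, transferIter_succ (n := n + 1), ← h.transfer_enlargedHole]
    ext x
    refine h.transfer_congr_of_fiber fun y hy hyx => ?_
    rw [domain_enlargedHole, indicator_indicator,
      inter_eq_left.2 (avoiding_anti H (Nat.le_succ m))]

/-- `m` applications of the operator already discard the mass that enters the hole at a time below
`m`. Thus the cutoff can be removed again at the price of `m` iterations. -/
theorem transferIter_indicator_avoiding (h : IsLasotaYorke T Z) (H : Set ℝ) (m : ℕ)
    (f : ℝ → ℝ) :
    transferIter T Z H m ((avoiding T H m).indicator f) =ᵐ[unitVolume] transferIter T Z H m f := by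
  induction m generalizing f with
  | zero =>
    refine ae_unitVolume_iff.2 (Eventually.of_forall fun x hx => ?_)
    rw [avoiding_zero]
    exact indicator_of_mem hx f
  | succ m ih =>
    have key : transfer T Z H ((avoiding T H (m + 1)).indicator f) =
        (avoiding T H m).indicator (transfer T Z H f) := by
      rw [← h.transfer_enlargedHole]
      ext x
      refine h.transfer_congr_of_fiber fun y hy hyx => ?_
      rw [domain_enlargedHole, indicator_indicator, ← avoiding_one (T := T),
        inter_eq_right.2 (avoiding_anti H (Nat.le_add_left 1 m))]
    rw [transferIter_succ', key, transferIter_succ']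
    exact ih _

end IsLasotaYorke

/-! ### Infima of ratios as almost everywhere inequalities, and their limits. -/

/-- Multiply by `w` where it is positive; where `w` vanishes, only `0 ≤ f` remains. The bounds `0 ≤
f ≤ C w` and the nonnull support keep the real-valued essential infimum from taking a junk value. -/
theorem le_essInf_div_iff {f w : ℝ → ℝ} {c C : ℝ}
    (hD : NullMeasurableSet {x | x ∈ Icc (0 : ℝ) 1 ∧ w x ≠ 0})
    (hD0 : volume {x | x ∈ Icc (0 : ℝ) 1 ∧ w x ≠ 0} ≠ 0) (hw : 0 ≤ᵐ[unitVolume] w)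
    (hf : 0 ≤ᵐ[unitVolume] f) (hfC : f ≤ᵐ[unitVolume] C • w) :
    c ≤ essInf (fun x => f x / w x) (volume.restrict {x | x ∈ Icc (0 : ℝ) 1 ∧ w x ≠ 0}) ↔
      c • w ≤ᵐ[unitVolume] f := by
  set D := {x | x ∈ Icc (0 : ℝ) 1 ∧ w x ≠ 0} with hDdef
  have hw' := ae_unitVolume_iff.1 hw
  have hf' := ae_unitVolume_iff.1 hf
  have hfC' := ae_unitVolume_iff.1 hfC
  have hlow : ∀ᵐ x ∂volume.restrict D, 0 ≤ f x / w x := by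
    rw [ae_restrict_iff'₀ hD]
    filter_upwards [hw', hf'] with x h1 h2 hx
    exact div_nonneg (h2 hx.1) (h1 hx.1)
  constructor
  · intro hc
    have hle := ae_essInf_le (isBoundedUnder_of_eventually_ge hlow)
    rw [ae_restrict_iff'₀ hD] at hle
    refine ae_unitVolume_iff.2 ?_
    filter_upwards [hw', hf', hfC', hle] with x h1 h2 h3 h4 hx
    by_cases hwx : w x = 0
    · simpa [hwx] using h2 hx
    · exact (le_div_iff₀ ((h1 hx).lt_of_ne' hwx)).1 (hc.trans (h4 ⟨hx, hwx⟩))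
  · intro hc
    have : NeBot (ae (volume.restrict D)) :=
      ae_neBot.2 fun h0 => hD0 (Measure.restrict_eq_zero.1 h0)
    have hup : ∀ᵐ x ∂volume.restrict D, f x / w x ≤ C := by
      rw [ae_restrict_iff'₀ hD]
      filter_upwards [hw', hfC'] with x h1 h2 hx
      exact (div_le_iff₀ ((h1 hx.1).lt_of_ne' hx.2)).2 (h2 hx.1)
    refine le_essInf_of_ae_le c ?_ (isBoundedUnder_of_eventually_le hup).isCoboundedUnder_ge
    have hc' := ae_unitVolume_iff.1 hc
    refine (ae_restrict_iff'₀ hD).2 ?_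
    filter_upwards [hw', hc'] with x h1 h2 hx
    exact (le_div_iff₀ ((h1 hx.1).lt_of_ne' hx.2)).2 (h2 hx.1)

/-- The supports of the functions `L^n 1` are measurable modulo null sets, and none is null. -/
def HasNonnullSupports (T : ℝ → ℝ) (Z : Finset (Set ℝ)) (K : Set ℝ) : Prop :=
  ∀ n, NullMeasurableSet (supportSet T Z K n) ∧ volume (supportSet T Z K n) ≠ 0

namespace IsLasotaYorke

theorem le_infRatio_iff (h : IsLasotaYorke T Z) {K : Set ℝ} (hK : HasNonnullSupports T Z K)
    {f : ℝ → ℝ} {c C : ℝ} (hf : 0 ≤ᵐ[unitVolume] f) (hfC : f ≤ᵐ[unitVolume] C • 1) (n : ℕ) :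
    c ≤ infRatio T Z K n (transferIter T Z K n f) ↔
      c • transferIter T Z K n 1 ≤ᵐ[unitVolume] transferIter T Z K n f := by
  refine le_essInf_div_iff (C := C) (hK n).1 (hK n).2 ?_ (h.transferIter_ae_nonneg K n hf) ?_
  · exact h.transferIter_ae_nonneg K n (Eventually.of_forall fun _ => zero_le_one)
  · rw [← h.transferIter_smul]
    exact h.transferIter_ae_mono K n hfC

theorem infRatio_smul_le (h : IsLasotaYorke T Z) {K : Set ℝ} (hK : HasNonnullSupports T Z K)
    {f : ℝ → ℝ} {C : ℝ} (hf : 0 ≤ᵐ[unitVolume] f) (hfC : f ≤ᵐ[unitVolume] C • 1) (n : ℕ) :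
    infRatio T Z K n (transferIter T Z K n f) • transferIter T Z K n 1
      ≤ᵐ[unitVolume] transferIter T Z K n f :=
  (h.le_infRatio_iff hK hf hfC n).1 le_rfl

/-- Applying the positive operator to `c L^n 1 ≤ L^n f` preserves the constant `c`. -/
theorem infRatio_monotone (h : IsLasotaYorke T Z) {K : Set ℝ} (hK : HasNonnullSupports T Z K)
    {f : ℝ → ℝ} {C : ℝ} (hf : 0 ≤ᵐ[unitVolume] f) (hfC : f ≤ᵐ[unitVolume] C • 1) :
    Monotone fun n => infRatio T Z K n (transferIter T Z K n f) := by
  refine monotone_nat_of_le_succ fun n => (h.le_infRatio_iff hK hf hfC (n + 1)).2 ?_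
  rw [transferIter_succ, transferIter_succ, ← h.transfer_smul]
  exact h.transfer_ae_mono K (h.infRatio_smul_le hK hf hfC n)

theorem infRatio_le (h : IsLasotaYorke T Z) {K : Set ℝ} (hK : HasNonnullSupports T Z K)
    {f : ℝ → ℝ} {C : ℝ} (hf : 0 ≤ᵐ[unitVolume] f) (hfC : f ≤ᵐ[unitVolume] C • 1) (n : ℕ) :
    infRatio T Z K n (transferIter T Z K n f) ≤ C := by
  have h1 := ae_unitVolume_iff.1 (h.infRatio_smul_le hK hf hfC n)
  have h2 := ae_unitVolume_iff.1 (h.transferIter_ae_mono K n hfC)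
  have h3 := ae_unitVolume_iff.1 (h.transferIter_ae_nonneg K n
    (f := 1) (Eventually.of_forall fun _ => zero_le_one))
  rw [h.transferIter_smul] at h2
  by_contra! hlt
  have hnull := ae_iff.1 (h1.and (h2.and h3))
  refine (hK n).2 (measure_mono_null ?_ hnull)
  rintro x hx ⟨a, b, d⟩
  have hpos := (d hx.1).lt_of_ne' hx.2
  have := (a hx.1).trans (b hx.1)
  simp only [Pi.smul_apply, smul_eq_mul] at this
  exact absurd (le_of_mul_le_mul_right this hpos) hlt.not_ge

theorem exists_tendsto_infRatio (h : IsLasotaYorke T Z) {K : Set ℝ}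
    (hK : HasNonnullSupports T Z K) {f : ℝ → ℝ} {C : ℝ} (hf : 0 ≤ᵐ[unitVolume] f)
    (hfC : f ≤ᵐ[unitVolume] C • 1) :
    ∃ ρ, Tendsto (fun n => infRatio T Z K n (transferIter T Z K n f)) atTop (𝓝 ρ) ∧
      ∀ n, infRatio T Z K n (transferIter T Z K n f) ≤ ρ := by
  have hb : BddAbove (range fun n => infRatio T Z K n (transferIter T Z K n f)) :=
    ⟨C, forall_mem_range.2 (h.infRatio_le hK hf hfC)⟩
  exact ⟨_, tendsto_atTop_ciSup (h.infRatio_monotone hK hf hfC) hb, le_ciSup hb⟩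

theorem transfer_one_nonneg (h : IsLasotaYorke T Z) (K : Set ℝ) :
    0 ≤ᵐ[unitVolume] transfer T Z K 1 :=
  h.transferIter_ae_nonneg K 1 (Eventually.of_forall fun _ => zero_le_one)

theorem transfer_one_ae_le (h : IsLasotaYorke T Z) (K : Set ℝ) :
    transfer T Z K 1 ≤ᵐ[unitVolume] (Z.card : ℝ) • 1 :=
  Eventually.of_forall fun x => by simpa using h.transfer_one_le K x

theorem transferIter_one_ae_le (h : IsLasotaYorke T Z) (K : Set ℝ) (n : ℕ) :
    transferIter T Z K n 1 ≤ᵐ[unitVolume] (Z.card : ℝ) ^ n • 1 := by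
  induction n with
  | zero => exact Eventually.of_forall fun x => by simp [transferIter]
  | succ n ih =>
    rw [transferIter_succ, pow_succ, mul_smul]
    refine (h.transfer_ae_mono K ih).trans ?_
    rw [h.transfer_smul]
    filter_upwards [h.transfer_one_ae_le K] with x hx
    exact mul_le_mul_of_nonneg_left hx (by positivity)

/-- Passing to an enlarged hole does not change the escape rate. -/
theorem isEscapeRate_enlargedHole (h : IsLasotaYorke T Z) {H : Set ℝ} {m : ℕ}
    (hH : HasNonnullSupports T Z H) (hHm : HasNonnullSupports T Z (enlargedHole T H m)) {ρ : ℝ}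
    (hρ : IsEscapeRate T Z H ρ) : IsEscapeRate T Z (enlargedHole T H m) ρ := by
  unfold IsEscapeRate at hρ ⊢
  -- Squeeze between the ratios of the original system at times `n` and `n + m`. Writing `L^{n+1} 1
  -- = L^n (L 1)` with `L 1` bounded brings them into the form of `le_infRatio_iff`.
  refine tendsto_of_tendsto_of_tendsto_of_le_of_le' hρ ((tendsto_add_atTop_iff_nat m).2 hρ) ?_ ?_
  · filter_upwards [eventually_ge_atTop 1] with n hn
    obtain ⟨n, rfl⟩ := Nat.exists_eq_add_of_le' hn
    rw [transferIter_succ' H (n + 1), transferIter_succ' (enlargedHole T H m) (n + 1),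
      h.le_infRatio_iff hHm (h.transfer_one_nonneg _) (h.transfer_one_ae_le _),
      ← transferIter_succ' (enlargedHole T H m) (n + 1), transferIter_enlargedHole h,
      transferIter_enlargedHole h, transferIter_succ' H (n + 1)]
    filter_upwards [h.infRatio_smul_le hH (h.transfer_one_nonneg _) (h.transfer_one_ae_le _)
      (n + 1)] with x hx
    by_cases hxA : x ∈ avoiding T H m
    · simpa [hxA] using hx
    · simp [hxA]
  · filter_upwards [eventually_ge_atTop 1] with n hn
    obtain ⟨n, rfl⟩ := Nat.exists_eq_add_of_le' hn
    have h1 := h.infRatio_smul_le hHm (h.transfer_one_nonneg (enlargedHole T H m))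
      (h.transfer_one_ae_le _) (n + 1)
    rw [← transferIter_succ' (enlargedHole T H m) (n + 1), transferIter_enlargedHole h,
      transferIter_enlargedHole h] at h1
    set c := infRatio T Z (enlargedHole T H m) (n + 1)
      ((avoiding T H m).indicator (transferIter T Z H (n + 1 + 1) 1)) with hc
    -- Applying `L^m` of the original system erases the cutoffs on both sides.
    have h2 := h.transferIter_ae_mono H m h1
    rw [h.transferIter_smul] at h2
    rw [transferIter_enlargedHole h, ← hc, transferIter_succ' H (n + 1 + m),
      h.le_infRatio_iff hH (h.transfer_one_nonneg _) (h.transfer_one_ae_le _),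
      ← transferIter_succ' H (n + 1 + m), add_comm (n + 1) m, add_assoc m (n + 1) 1,
      transferIter_add H m (n + 1), transferIter_add H m (n + 1 + 1)]
    filter_upwards [h2, h.transferIter_indicator_avoiding H m (transferIter T Z H (n + 1) 1),
      h.transferIter_indicator_avoiding H m (transferIter T Z H (n + 1 + 1) 1)] with x a b d
    rw [Pi.smul_apply] at a ⊢
    rwa [b, d] at a

end IsLasotaYorke

/-! ### Positivity for full-branched maps. -/

variable {H : Set ℝ}

namespace IsFullBranched

theorem subset_hole_or_full (h : IsFullBranched T Z H) {A : Set ℝ} (hA : A ∈ Z) :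
    A ⊆ H ∨ A ∈ fullBranches T Z H := by
  by_contra! hn
  exact (Set.ext_iff.1 h.full A).1 ⟨hA, fun hu => hu.elim (fun hh => hn.1 hh.2) hn.2⟩

theorem full_subset_domain (h : IsFullBranched T Z H) {A : Set ℝ}
    (hA : A ∈ fullBranches T Z H) : A ⊆ domain H := fun _ hx =>
  ⟨h.lasotaYorke.partition.subset_Icc hA.1 hx, disjoint_left.1 hA.2.1 hx⟩

theorem exists_full_of_mem_domain (h : IsFullBranched T Z H) {x : ℝ} (hx : x ∈ domain H) :
    ∃ A ∈ fullBranches T Z H, x ∈ A := by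
  obtain ⟨A, hA, hxA⟩ := h.lasotaYorke.partition.exists_mem hx.1
  exact ⟨A, (h.subset_hole_or_full hA).resolve_left fun hs => hx.2 (hs hxA), hxA⟩

theorem iUnion_fullBranches (h : IsFullBranched T Z H) :
    (⋃ A ∈ fullBranches T Z H, A) = domain H := by
  ext x
  simp only [mem_iUnion, exists_prop]
  exact ⟨fun ⟨A, hA, hx⟩ => h.full_subset_domain hA hx, h.exists_full_of_mem_domain⟩

theorem exists_full (h : IsFullBranched T Z H) : ∃ A, A ∈ fullBranches T Z H := by
  obtain ⟨x, hx, hxH⟩ := exists_of_ssubset h.hole.2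
  obtain ⟨A, hA, -⟩ := h.exists_full_of_mem_domain ⟨hx, hxH⟩
  exact ⟨A, hA⟩

theorem exists_nat_bound (h : IsFullBranched T Z H) :
    ∃ M : ℕ, ∀ A ∈ fullBranches T Z H, ∀ x ∈ A, |branchDeriv T Z x| ≤ M := by
  choose! M hM using fun A hA => h.lasotaYorke.exists_branchDeriv_le (A := A) hA
  obtain ⟨N, hN⟩ := exists_nat_ge (∑ A ∈ Z, |M A|)
  refine ⟨N, fun A hA x hx => (hM A hA.1 x hx).trans ((le_abs_self _).trans ?_)⟩
  exact (Finset.single_le_sum (f := fun A => |M A|) (fun _ _ => abs_nonneg _) hA.1).trans hN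

theorem inv_le_weight (h : IsFullBranched T Z H) {A : Set ℝ}
    (hA : A ∈ fullBranches T Z H) {x : ℝ} (hx : x ∈ A) {M : ℝ} (hM : |branchDeriv T Z x| ≤ M) :
    0 < M⁻¹ ∧ M⁻¹ ≤ weight T Z x := by
  have hpos : 0 < |branchDeriv T Z x| :=
    inv_pos.1 (h.lasotaYorke.weight_pos (h.full_subset_domain hA hx).1)
  exact ⟨inv_pos.2 (hpos.trans_le hM), inv_anti₀ hpos hM⟩

theorem exists_le_weight (h : IsFullBranched T Z H) :
    ∃ c : ℝ, 0 < c ∧ ∀ A ∈ fullBranches T Z H, ∀ x ∈ A, c ≤ weight T Z x := by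
  obtain ⟨M, hM⟩ := h.exists_nat_bound
  refine ⟨((M : ℝ) + 1)⁻¹, by positivity, fun A hA x hx => ?_⟩
  exact (h.inv_le_weight hA hx ((hM A hA x hx).trans (by linarith))).2

/-- Every full branch maps onto the unit interval with bounded derivative. -/
theorem exists_le_transfer_indicator (h : IsFullBranched T Z H) :
    ∃ c : ℝ, 0 < c ∧ ∀ A ∈ fullBranches T Z H,
      c • (1 : ℝ → ℝ) ≤ᵐ[unitVolume] transfer T Z H (A.indicator 1) := by
  obtain ⟨c, hc, hcw⟩ := h.exists_le_weight
  refine ⟨c, hc, fun A hA => ae_unitVolume_of_Ioo fun x hx => ?_⟩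
  obtain ⟨y, hyA, rfl⟩ := hA.2.2 hx
  simpa using (hcw A hA y hyA).trans
    (h.lasotaYorke.weight_le_transfer_indicator hyA (h.full_subset_domain hA hyA))

/-- A single full branch gives `L 1 ≥ c`, and positivity iterates this to `L^n 1 ≥ c^n`. -/
theorem exists_le_transferIter_one (h : IsFullBranched T Z H) (n : ℕ) :
    ∃ c : ℝ, 0 < c ∧ c • (1 : ℝ → ℝ) ≤ᵐ[unitVolume] transferIter T Z H n 1 := by
  obtain ⟨c, hc, hcA⟩ := h.exists_le_transfer_indicator
  obtain ⟨A, hA⟩ := h.exists_full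
  have h1 : c • (1 : ℝ → ℝ) ≤ᵐ[unitVolume] transfer T Z H 1 :=
    (hcA A hA).trans (h.lasotaYorke.transfer_ae_mono H
      (Eventually.of_forall fun x => indicator_le_self' (fun _ _ => zero_le_one) x))
  refine ⟨c ^ n, pow_pos hc n, ?_⟩
  induction n with
  | zero => exact Eventually.of_forall fun x => by simp [transferIter]
  | succ n ih =>
    have := h.lasotaYorke.transfer_ae_mono H ih
    rw [transferIter_succ]
    refine EventuallyLE.trans ?_ this
    rw [h.lasotaYorke.transfer_smul, pow_succ, mul_smul]
    filter_upwards [h1] with x hx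
    exact mul_le_mul_of_nonneg_left hx (pow_nonneg hc.le n)

theorem ae_transferIter_one_pos (h : IsFullBranched T Z H) :
    ∀ᵐ x ∂unitVolume, ∀ n, 0 < transferIter T Z H n 1 x := by
  refine ae_all_iff.2 fun n => ?_
  obtain ⟨c, hc, hcn⟩ := h.exists_le_transferIter_one n
  filter_upwards [hcn] with x hx
  exact hc.trans_le (by simpa using hx)

/-- Otherwise `L^m 1 = L^m (1_{avoiding m})` would vanish a.e., contradicting positivity. -/
theorem volume_avoiding_ne_zero (h : IsFullBranched T Z H) (m : ℕ) :
    volume (avoiding T H m) ≠ 0 := by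
  intro h0
  have hz : (avoiding T H m).indicator (1 : ℝ → ℝ) =ᵐ[unitVolume] 0 := by
    refine ae_restrict_of_ae (measure_mono_null (fun x hx => ?_) h0)
    by_contra hx'
    exact hx (indicator_of_notMem hx' _)
  have hle := h.lasotaYorke.transferIter_ae_mono H m hz.le
  rw [h.lasotaYorke.transferIter_zero_fun] at hle
  have hfalse : ∀ᵐ x ∂unitVolume, False := by
    filter_upwards [hle, h.ae_transferIter_one_pos,
      h.lasotaYorke.transferIter_indicator_avoiding H m 1] with x h1 h2 h3
    rw [h3] at h1
    exact (h2 m).not_ge h1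
  rw [eventually_false_iff_eq_bot, ae_eq_bot, Measure.restrict_eq_zero] at hfalse
  simp at hfalse

end IsFullBranched

/-! ### Cylinders: structure, size and covering. -/

open Classical in
/-- The partition into hole branches and preimages under full branches, iterated `m` times. -/
noncomputable def cylinderPartition (T : ℝ → ℝ) (Z : Finset (Set ℝ)) (H : Set ℝ) :
    ℕ → Finset (Set ℝ)
  | 0 => Z
  | m + 1 => Z.filter (· ⊆ H) ∪ (Z.filter (· ∈ fullBranches T Z H) ×ˢ
      cylinderPartition T Z H m).image fun q => q.1 ∩ T ⁻¹' q.2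

theorem mem_cylinderPartition_succ {m : ℕ} {B : Set ℝ} :
    B ∈ cylinderPartition T Z H (m + 1) ↔ (B ∈ Z ∧ B ⊆ H) ∨
      ∃ A ∈ fullBranches T Z H, ∃ C ∈ cylinderPartition T Z H m, A ∩ T ⁻¹' C = B := by
  simp only [cylinderPartition, Finset.mem_union, Finset.mem_filter, Finset.mem_image,
    Finset.mem_product, Prod.exists]
  refine or_congr_right ⟨?_, ?_⟩
  · rintro ⟨A, C, ⟨⟨-, hA⟩, hC⟩, rfl⟩
    exact ⟨A, hA, C, hC, rfl⟩
  · rintro ⟨A, hA, C, hC, rfl⟩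
    exact ⟨A, C, ⟨⟨hA.1, hA⟩, hC⟩, rfl⟩

namespace IsFullBranched

theorem isIntervalPartition_cylinderPartition (h : IsFullBranched T Z H) (m : ℕ) :
    IsIntervalPartition (cylinderPartition T Z H m) := by
  have hZ := h.lasotaYorke.partition
  induction m with
  | zero => exact hZ
  | succ m ih =>
    refine ⟨fun B hB => ?_, fun B hB => ?_, fun B hB B' hB' hne => ?_, ?_⟩
    · rcases mem_cylinderPartition_succ.1 hB with ⟨hBZ, -⟩ | ⟨A, hA, C, hC, rfl⟩
      · exact hZ.ordConnected B hBZ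
      · exact h.lasotaYorke.ordConnected_inter_preimage hA.1 (ih.ordConnected C hC)
    · rcases mem_cylinderPartition_succ.1 hB with ⟨hBZ, -⟩ | ⟨A, hA, C, hC, rfl⟩
      · exact hZ.nondegenerate B hBZ
      · exact h.lasotaYorke.interior_inter_preimage_nonempty hA.1 hA.2.2
          (ih.nondegenerate C hC) (ih.subset_Icc hC)
    · refine disjoint_left.2 fun x (hx : x ∈ B) (hx' : x ∈ B') => hne ?_
      rcases mem_cylinderPartition_succ.1 hB with ⟨hBZ, hBH⟩ | ⟨A, hA, C, hC, rfl⟩ <;>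
      rcases mem_cylinderPartition_succ.1 hB' with ⟨hBZ', hBH'⟩ | ⟨A', hA', C', hC', rfl⟩
      · exact hZ.eq_of_mem hBZ hBZ' hx hx'
      · exact absurd (hBH hx) (disjoint_left.1 hA'.2.1 hx'.1)
      · exact absurd (hBH' hx') (disjoint_left.1 hA.2.1 hx.1)
      · rw [hZ.eq_of_mem hA.1 hA'.1 hx.1 hx'.1, ih.eq_of_mem hC hC' hx.2 hx'.2]
    · refine Subset.antisymm (iUnion₂_subset fun B hB => ?_) fun x hx => ?_
      · rcases mem_cylinderPartition_succ.1 hB with ⟨hBZ, -⟩ | ⟨A, hA, C, hC, rfl⟩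
        · exact hZ.subset_Icc hBZ
        · exact inter_subset_left.trans (hZ.subset_Icc hA.1)
      · obtain ⟨A, hA, hxA⟩ := hZ.exists_mem hx
        rcases h.subset_hole_or_full hA with hAH | hAf
        · exact mem_biUnion (mem_cylinderPartition_succ.2 (Or.inl ⟨hA, hAH⟩)) hxA
        · obtain ⟨C, hC, hxC⟩ := ih.exists_mem (h.lasotaYorke.mapsTo hx)
          exact mem_biUnion (t := fun B : Set ℝ => B)
            (mem_cylinderPartition_succ.2 (Or.inr ⟨A, hAf, C, hC, rfl⟩)) ⟨hxA, hxC⟩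

theorem disjoint_avoiding_or_subset (h : IsFullBranched T Z H) {m : ℕ} {B : Set ℝ}
    (hB : B ∈ cylinderPartition T Z H m) :
    Disjoint B (avoiding T H (m + 1)) ∨ B ⊆ avoiding T H (m + 1) := by
  have hhole : ∀ B : Set ℝ, B ⊆ H → ∀ n, Disjoint B (avoiding T H (n + 1)) := fun B hBH n =>
    disjoint_left.2 fun x hx hxA => hxA.2 0 n.succ_pos (hBH hx)
  induction m generalizing B with
  | zero =>
    rcases h.subset_hole_or_full hB with hBH | hBf
    · exact Or.inl (hhole B hBH 0)
    · exact Or.inr (avoiding_one (T := T) H ▸ h.full_subset_domain hBf)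
  | succ m ih =>
    rcases mem_cylinderPartition_succ.1 hB with ⟨-, hBH⟩ | ⟨A, hA, C, hC, rfl⟩
    · exact Or.inl (hhole B hBH (m + 1))
    · refine (ih hC).imp (fun hd => disjoint_left.2 fun x hx hxA => ?_) fun hs x hx => ?_
      · exact disjoint_left.1 hd hx.2 ((mem_avoiding_succ h.lasotaYorke.mapsTo).1 hxA).2
      · exact (mem_avoiding_succ h.lasotaYorke.mapsTo).2
          ⟨h.full_subset_domain hA hx.1, hs hx.2⟩

/-- A surviving cylinder is built from full branches only. Following the orbit of one of its points
shows that no hole branch occurs in its construction. -/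
theorem cylinder_induction (h : IsFullBranched T Z H) {p : ℕ → Set ℝ → Prop}
    (zero : ∀ A ∈ fullBranches T Z H, p 0 A)
    (succ : ∀ m, ∀ A ∈ fullBranches T Z H, ∀ C ∈ cylinderPartition T Z H m, p m C →
      p (m + 1) (A ∩ T ⁻¹' C)) (m : ℕ) {B : Set ℝ} (hB : B ∈ cylinderPartition T Z H m)
    (hBX : B ⊆ avoiding T H (m + 1)) : p m B := by
  have hne : B.Nonempty :=
    ((h.isIntervalPartition_cylinderPartition m).nondegenerate B hB).mono interior_subset
  obtain ⟨x, hx⟩ := hne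
  have hxX := hBX hx
  induction m generalizing B x with
  | zero =>
    refine zero B ((h.subset_hole_or_full hB).resolve_left fun hBH => ?_)
    exact hxX.2 0 one_pos (hBH hx)
  | succ m ih =>
    rcases mem_cylinderPartition_succ.1 hB with ⟨-, hBH⟩ | ⟨A, hA, C, hC, rfl⟩
    · exact absurd (hBH hx) (hxX.2 0 (Nat.succ_pos _))
    · have hTx := ((mem_avoiding_succ h.lasotaYorke.mapsTo).1 hxX).2
      exact succ m A hA C hC (ih hC ((h.disjoint_avoiding_or_subset hC).resolve_left
        fun hd => disjoint_left.1 hd hx.2 hTx) (T x) hx.2 hTx)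

theorem exists_full_superset (h : IsFullBranched T Z H) {m : ℕ} {B : Set ℝ}
    (hB : B ∈ cylinderPartition T Z H m) (hBX : B ⊆ avoiding T H (m + 1)) :
    ∃ A ∈ fullBranches T Z H, B ⊆ A :=
  h.cylinder_induction (p := fun _ B => ∃ A ∈ fullBranches T Z H, B ⊆ A)
    (fun A hA => ⟨A, hA, Subset.rfl⟩) (fun _ A hA _ _ _ => ⟨A, hA, inter_subset_left⟩) m hB hBX

/-- By the mean value theorem each of the `m + 1` full branches contributes a factor `θ`, starting
from the length one of the unit interval. -/
theorem cylinder_length_le (h : IsFullBranched T Z H) {θ : ℝ}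
    (hθ : ∀ A ∈ fullBranches T Z H, ∀ x ∈ A, weight T Z x ≤ θ) {m : ℕ} {B : Set ℝ}
    (hB : B ∈ cylinderPartition T Z H m) (hBX : B ⊆ avoiding T H (m + 1)) :
    ∀ a ∈ B, ∀ b ∈ B, |b - a| ≤ θ ^ (m + 1) := by
  have hθ0 : 0 ≤ θ := by
    obtain ⟨A, hA⟩ := h.exists_full
    obtain ⟨x, hx⟩ := h.lasotaYorke.partition.nondegenerate A hA.1
    exact (weight_nonneg x).trans (hθ A hA x (interior_subset hx))
  have step : ∀ A ∈ fullBranches T Z H, ∀ a ∈ A, ∀ b ∈ A, |b - a| ≤ θ * |T b - T a| := by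
    intro A hA a ha b hb
    wlog hab : a ≤ b generalizing a b
    · rw [abs_sub_comm b, abs_sub_comm (T b)]
      exact this b hb a ha (le_of_not_ge hab)
    rcases hab.eq_or_lt with rfl | hab
    · simp
    obtain ⟨c, hc, he⟩ := h.lasotaYorke.exists_weight_mul_eq hA.1 ha hb hab
    rw [abs_of_pos (sub_pos.2 hab), he]
    exact mul_le_mul_of_nonneg_right (hθ A hA c hc) (abs_nonneg _)
  refine h.cylinder_induction (p := fun m B => ∀ a ∈ B, ∀ b ∈ B, |b - a| ≤ θ ^ (m + 1))
    (fun A hA a ha b hb => ?_) (fun m A hA C hC ih a ha b hb => ?_) m hB hBX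
  · have hmaps := h.lasotaYorke.mapsTo
    have hTa := hmaps (h.full_subset_domain hA ha).1
    have hTb := hmaps (h.full_subset_domain hA hb).1
    have : |T b - T a| ≤ 1 := abs_le.2 ⟨by linarith [hTa.2, hTb.1], by linarith [hTa.1, hTb.2]⟩
    simpa using (step A hA a ha b hb).trans (mul_le_mul_of_nonneg_left this hθ0)
  · rw [pow_succ']
    exact (step A hA a ha.1 b hb.1).trans (mul_le_mul_of_nonneg_left (ih _ ha.2 _ hb.2) hθ0)

/-- Cylinders of order `m + 1` are mapped onto the unit interval by `T^[m + 1]`, with bounded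
derivative. -/
theorem exists_le_transferIter_cylinder (h : IsFullBranched T Z H) {m : ℕ} {B : Set ℝ}
    (hB : B ∈ cylinderPartition T Z H m) (hBX : B ⊆ avoiding T H (m + 1)) :
    ∃ c : ℝ, 0 < c ∧
      c • (1 : ℝ → ℝ) ≤ᵐ[unitVolume] transferIter T Z H (m + 1) (B.indicator 1) := by
  obtain ⟨c₀, hc₀, hle⟩ := h.exists_le_transfer_indicator
  refine h.cylinder_induction (p := fun m B => ∃ c : ℝ, 0 < c ∧
      c • (1 : ℝ → ℝ) ≤ᵐ[unitVolume] transferIter T Z H (m + 1) (B.indicator 1))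
    (fun A hA => ⟨c₀, hc₀, hle A hA⟩) (fun m A hA C hC => ?_) m hB hBX
  rintro ⟨c, hc, hcC⟩
  refine ⟨c₀ * c, mul_pos hc₀ hc, ?_⟩
  -- One step turns the indicator of `A ∩ T ⁻¹' C` into at least `c₀` times that of `C`, to which
  -- the induction hypothesis applies.
  have hTI : transfer T Z H ((A ∩ T ⁻¹' C).indicator 1) =
      C.indicator (transfer T Z H (A.indicator 1)) := by
    rw [← h.lasotaYorke.transfer_indicator_preimage, indicator_indicator, inter_comm]
  have hlow : c₀ • C.indicator (1 : ℝ → ℝ) ≤ᵐ[unitVolume]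
      transfer T Z H ((A ∩ T ⁻¹' C).indicator 1) := by
    rw [hTI]
    filter_upwards [hle A hA] with x hx
    by_cases hxC : x ∈ C
    · simpa [hxC] using hx
    · simp [hxC]
  rw [transferIter_succ']
  refine EventuallyLE.trans ?_ (h.lasotaYorke.transferIter_ae_mono H (m + 1) hlow)
  rw [h.lasotaYorke.transferIter_smul, mul_smul]
  filter_upwards [hcC] with x hx
  exact mul_le_mul_of_nonneg_left hx hc₀.le

/-- For positive `m` the set is a finite union of cylinders, which are intervals. -/
theorem nullMeasurableSet_avoiding (h : IsFullBranched T Z H) (m : ℕ) :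
    NullMeasurableSet (avoiding T H m) := by
  cases m with
  | zero => exact avoiding_zero (T := T) H ▸ measurableSet_Icc.nullMeasurableSet
  | succ m =>
    have hP := h.isIntervalPartition_cylinderPartition m
    have : avoiding T H (m + 1) =
        ⋃ B ∈ {B | B ∈ cylinderPartition T Z H m ∧ B ⊆ avoiding T H (m + 1)}, B := by
      refine Subset.antisymm (fun x hx => ?_) (iUnion₂_subset fun B hB => hB.2)
      obtain ⟨B, hB, hxB⟩ := hP.exists_mem hx.1
      have hBX := (h.disjoint_avoiding_or_subset hB).resolve_left
        fun hd => disjoint_left.1 hd hxB hx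
      exact mem_biUnion (t := fun B : Set ℝ => B) ⟨hB, hBX⟩ hxB
    rw [this]
    exact (MeasurableSet.biUnion ((cylinderPartition T Z H m).countable_toSet.mono
      fun B hB => hB.1) fun B hB => (hP.ordConnected B hB.1).measurableSet).nullMeasurableSet

/-! ### Supports, and goodness of surviving cylinders. -/

theorem supportSet_ae_eq (h : IsFullBranched T Z H) (n : ℕ) :
    supportSet T Z H n =ᵐ[volume] Icc (0 : ℝ) 1 := by
  filter_upwards [ae_unitVolume_iff.1 h.ae_transferIter_one_pos] with x hx
  exact propext ⟨fun hx' => hx'.1, fun hx' => ⟨hx', (hx hx' n).ne'⟩⟩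

theorem hasNonnullSupports (h : IsFullBranched T Z H) : HasNonnullSupports T Z H := fun n =>
  ⟨measurableSet_Icc.nullMeasurableSet.congr (h.supportSet_ae_eq n).symm, by
    rw [measure_congr (h.supportSet_ae_eq n)]; simp⟩

theorem supportSet_enlargedHole_ae_eq (h : IsFullBranched T Z H) (m n : ℕ) :
    supportSet T Z (enlargedHole T H m) (n + 1) =ᵐ[volume] avoiding T H m := by
  filter_upwards [ae_unitVolume_iff.1 h.ae_transferIter_one_pos] with x hx
  refine propext ⟨fun hx' => ?_, fun (hx' : x ∈ avoiding T H m) => ⟨hx'.1, ?_⟩⟩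
  · show x ∈ avoiding T H m
    have := hx'.2
    rw [h.lasotaYorke.transferIter_enlargedHole] at this
    exact mem_of_indicator_ne_zero this
  · rw [h.lasotaYorke.transferIter_enlargedHole, indicator_of_mem hx']
    exact (hx hx'.1 _).ne'

theorem hasNonnullSupports_enlargedHole (h : IsFullBranched T Z H) (m : ℕ) :
    HasNonnullSupports T Z (enlargedHole T H m) := by
  intro n
  cases n with
  | zero =>
    have : supportSet T Z (enlargedHole T H m) 0 = Icc 0 1 := by
      ext x
      simp [supportSet, transferIter]
    rw [this]
    exact ⟨measurableSet_Icc.nullMeasurableSet, by simp⟩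
  | succ n =>
    have hae := h.supportSet_enlargedHole_ae_eq m n
    refine ⟨(h.nullMeasurableSet_avoiding m).congr hae.symm, ?_⟩
    rw [measure_congr hae]
    exact h.volume_avoiding_ne_zero m

theorem volume_supportInfty_ne_zero (h : IsFullBranched T Z H) (m : ℕ) :
    volume (supportInfty T Z (enlargedHole T H m)) ≠ 0 := by
  have hae : supportInfty T Z (enlargedHole T H m) =ᵐ[volume] avoiding T H m := by
    have := ae_all_iff.2 (h.supportSet_enlargedHole_ae_eq m)
    filter_upwards [this] with x hx
    refine propext ⟨fun hx' => (hx 0).mp (mem_iInter₂.1 hx' 1 le_rfl), fun hx' => ?_⟩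
    refine mem_iInter₂.2 fun n hn => ?_
    obtain ⟨n, rfl⟩ := Nat.exists_eq_add_of_le' hn
    exact (hx n).mpr hx'
  rw [measure_congr hae]
  exact h.volume_avoiding_ne_zero m

theorem isGood_cylinder (h : IsFullBranched T Z H) {m : ℕ} {B : Set ℝ}
    (hB : B ∈ cylinderPartition T Z H m) (hBX : B ⊆ avoiding T H (m + 1)) :
    IsGood T Z (enlargedHole T H m) B := by
  have hK := h.hasNonnullSupports_enlargedHole m
  have hf : 0 ≤ᵐ[unitVolume] B.indicator (1 : ℝ → ℝ) :=
    Eventually.of_forall fun x => indicator_nonneg (fun _ _ => zero_le_one) x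
  have hfC : B.indicator (1 : ℝ → ℝ) ≤ᵐ[unitVolume] (1 : ℝ) • 1 := by
    rw [one_smul]
    exact Eventually.of_forall fun x => indicator_le_self' (fun _ _ => zero_le_one) x
  obtain ⟨ρ, hρ, hle⟩ := h.lasotaYorke.exists_tendsto_infRatio hK hf hfC
  refine ⟨ρ, ?_, hρ⟩
  obtain ⟨c, hc, hcB⟩ := h.exists_le_transferIter_cylinder hB hBX
  -- The limit is at least the ratio at time `m + 1`. There the numerator is at least `c` and the
  -- denominator at most `D`, before a common cutoff; the added one makes `D` positive.
  set D : ℝ := (Z.card : ℝ) ^ (m + 1) + 1 with hD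
  have hDpos : 0 < D := by positivity
  refine (div_pos hc hDpos).trans_le (le_trans ?_ (hle (m + 1)))
  rw [h.lasotaYorke.le_infRatio_iff hK hf hfC, h.lasotaYorke.transferIter_enlargedHole,
    h.lasotaYorke.transferIter_enlargedHole]
  filter_upwards [hcB, h.lasotaYorke.transferIter_one_ae_le H (m + 1)] with x h1 h2
  by_cases hx : x ∈ avoiding T H m
  · simp only [Pi.smul_apply, smul_eq_mul, Pi.one_apply, mul_one, indicator_of_mem hx] at h1 h2 ⊢
    refine le_trans ?_ h1
    rw [div_mul_eq_mul_div, div_le_iff₀ hDpos]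
    exact mul_le_mul_of_nonneg_left (by linarith) hc.le
  · simp [hx]

theorem badElements_cylinderPartition (h : IsFullBranched T Z H) (m : ℕ) :
    badElements T Z (enlargedHole T H m) (cylinderPartition T Z H m) = ∅ := by
  refine eq_empty_of_forall_notMem fun B hB => hB.2 (h.isGood_cylinder hB.1.1 ?_)
  have hint := hB.1.2
  rw [domain_enlargedHole] at hint
  refine (h.disjoint_avoiding_or_subset hB.1.1).resolve_left fun hd => ?_
  obtain ⟨x, hx⟩ := (h.isIntervalPartition_cylinderPartition m).nondegenerate B hB.1.1
  exact disjoint_left.1 hd (interior_subset hx) (hint hx)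

end IsFullBranched

/-! ### The algorithm. -/

/-- The iteration count read off from an initial segment of a description, once it is long
enough. -/
def iterationCount (l : List ℕ) : Option ℕ :=
  l[1]?.bind fun a => l[2]?.bind fun b => l[b + 3]?.bind fun c => some ((a + 1) * c)

theorem computable_iterationCount : Computable iterationCount := by
  refine Primrec.to_comp ?_
  have get : ∀ {α : Type} [Primcodable α] {l : α → List ℕ} {i : α → ℕ}, Primrec l → Primrec i →
      Primrec fun x => (l x)[i x]? := fun hl hi => Primrec.list_getElem?.comp hl hi
  refine Primrec.option_bind (get Primrec.id (Primrec.const 1)) ?_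
  refine Primrec.option_bind (get Primrec.fst (Primrec.const 2)) ?_
  refine Primrec.option_bind (get (Primrec.fst.comp Primrec.fst)
    (Primrec.nat_add.comp Primrec.snd (Primrec.const 3))) ?_
  exact Primrec.option_some.comp (Primrec.nat_mul.comp
    (Primrec.succ.comp (Primrec.snd.comp (Primrec.fst.comp Primrec.fst))) Primrec.snd)

theorem outputs_iterationCount (p : ℕ → ℕ) :
    Outputs iterationCount p ((p 1 + 1) * p (p 2 + 3)) := by
  have get : ∀ n i, i < n → ((List.range n).map p)[i]? = some (p i) := fun n i hi => by
    simp [hi]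
  -- The last entry needed has index `p 2 + 3`, so the first answer comes at length `p 2 + 4`.
  refine ⟨p 2 + 4, ?_, fun n hn => ?_⟩
  · rw [iterationCount, get _ 1 (by lia), get _ 2 (by lia)]
    simp
  · have none_of : ∀ i, n ≤ i → ((List.range n).map p)[i]? = none := fun i hi => by simp [hi]
    rw [iterationCount]
    rcases le_or_gt n 2 with h | h
    · rw [none_of 2 h]
      simp
    · rw [get n 2 h, get n 1 (by lia)]
      simp only [Option.bind_some]
      rw [none_of (p 2 + 3) (by lia)]
      rfl

/-- `(1 - 1/(n+1))^{n+1} ≤ e⁻¹ ≤ 1/2`. This explains the factor `p 1 + 1` in the iteration count: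
that many iterations halve the length bound. -/
theorem one_sub_inv_pow_le_half (n k : ℕ) :
    (1 - 1 / ((n : ℝ) + 1)) ^ ((n + 1) * k) ≤ (1 / 2) ^ k := by
  have hn : (0 : ℝ) < n + 1 := by positivity
  have h0 : (0 : ℝ) ≤ 1 - 1 / ((n : ℝ) + 1) := by
    rw [sub_nonneg, div_le_one hn]
    linarith [(Nat.cast_nonneg n : (0 : ℝ) ≤ n)]
  rw [pow_mul]
  refine pow_le_pow_left₀ (pow_nonneg h0 _) ?_ k
  have h1 : 1 - 1 / ((n : ℝ) + 1) ≤ Real.exp (-(1 / ((n : ℝ) + 1))) := by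
    linarith [Real.add_one_le_exp (-(1 / ((n : ℝ) + 1)))]
  refine (pow_le_pow_left₀ h0 h1 _).trans ?_
  rw [← Real.exp_nat_mul]
  have : ((n + 1 : ℕ) : ℝ) * -(1 / ((n : ℝ) + 1)) = -1 := by
    push_cast
    field_simp
  rw [this, Real.exp_neg, one_div]
  exact inv_anti₀ two_pos (by linarith [Real.add_one_le_exp (1 : ℝ)])

/-! ### Existence of descriptions, adequacy and the final bounds. -/

namespace IsFullBranched

theorem exists_isDescription (h : IsFullBranched T Z H) {ε : ℝ} (hε : 0 < ε) :
    ∃ p : ℕ → ℕ, IsDescription T Z H ε p := by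
  have hLY := h.lasotaYorke
  obtain ⟨e, he⟩ := exists_pow_lt_of_lt_one hε (one_half_lt_one (α := ℝ))
  obtain ⟨Θ, hΘ1, hΘ⟩ := hLY.expanding
  obtain ⟨q, hq⟩ := exists_nat_one_div_lt (sub_pos.2 hΘ1)
  obtain ⟨M, hM⟩ := h.exists_nat_bound
  have hmod : ∀ k : ℕ, ∃ N : ℕ, ∀ A ∈ Z, ∀ a ∈ A, ∀ b ∈ A, a ≤ b → b - a ≤ (1 / 2 : ℝ) ^ N →
      eVariationOn (weight T Z) (Icc a b) ≤ ENNReal.ofReal ((1 / 2 : ℝ) ^ k) := by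
    intro k
    have hA : ∀ A ∈ Z, ∃ N : ℕ, ∀ a ∈ A, ∀ b ∈ A, a ≤ b → b - a ≤ (1 / 2 : ℝ) ^ N →
        eVariationOn (weight T Z) (Icc a b) ≤ ENNReal.ofReal ((1 / 2 : ℝ) ^ k) := by
      intro A hA
      have hAI := hLY.partition.subset_Icc hA
      obtain ⟨δ, hδ, hδA⟩ := exists_modulus_of_variation (hLY.partition.ordConnected A hA) hAI
        (hLY.boundedVariation.mono hAI) (hLY.weight_continuousOn hA)
        (η := ENNReal.ofReal ((1 / 2 : ℝ) ^ k)) (ENNReal.ofReal_pos.2 (by positivity))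
      obtain ⟨N, hN⟩ := exists_pow_lt_of_lt_one hδ (one_half_lt_one (α := ℝ))
      exact ⟨N, fun a ha b hb hab hle => hδA a ha b hb hab (hle.trans_lt hN)⟩
    choose! N hN using hA
    -- The sum dominates every `N A`, so one exponent serves all branches.
    refine ⟨∑ A ∈ Z, N A, fun A hA a ha b hb hab hle => hN A hA a ha b hb hab (hle.trans ?_)⟩
    exact pow_le_pow_of_le_one (by norm_num) (by norm_num)
      (Finset.single_le_sum (fun _ _ => Nat.zero_le _) hA)
  choose N hN using hmod
  refine ⟨fun i => match i with
    | 0 => e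
    | 1 => q
    | 2 => M
    | k + 3 => N k, he.le, fun A hA x hx => ?_, hM, fun k A hA => hN k A hA.1⟩
  have := (hΘ x (hLY.partition.subset_Icc hA.1 hx)).2
  show weight T Z x ≤ 1 - 1 / ((q : ℝ) + 1)
  linarith

theorem bddAbove_weight_image (h : IsFullBranched T Z H) {s : Set ℝ} (hs : s ⊆ Icc 0 1) :
    BddAbove (weight T Z '' s) :=
  ⟨1, forall_mem_image.2 fun _ hx => h.lasotaYorke.weight_le_one (hs hx)⟩

theorem inv_le_invDerivNorm (h : IsFullBranched T Z H) {M : ℝ}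
    (hM : ∀ A ∈ fullBranches T Z H, ∀ x ∈ A, |branchDeriv T Z x| ≤ M) (m : ℕ) :
    0 < M⁻¹ ∧ M⁻¹ ≤ invDerivNorm T Z (enlargedHole T H m) := by
  rw [invDerivNorm, domain_enlargedHole]
  have hne : (avoiding T H (m + 1)).Nonempty :=
    nonempty_of_measure_ne_zero (h.volume_avoiding_ne_zero (m + 1))
  obtain ⟨x, hx⟩ := hne
  obtain ⟨A, hA, hxA⟩ :=
    h.exists_full_of_mem_domain ((mem_avoiding_succ h.lasotaYorke.mapsTo).1 hx).1
  obtain ⟨h1, h2⟩ := h.inv_le_weight hA hxA (hM A hA x hxA)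
  exact ⟨h1, h2.trans (le_csSup (h.bddAbove_weight_image (avoiding_subset_Icc H _))
    (mem_image_of_mem _ hx))⟩

theorem invDerivNorm_enlargedHole_le (h : IsFullBranched T Z H) (m : ℕ) :
    invDerivNorm T Z (enlargedHole T H m) ≤
      sSup (weight T Z '' ⋃ A ∈ fullBranches T Z H, A) := by
  rw [invDerivNorm, domain_enlargedHole, h.iUnion_fullBranches]
  refine csSup_le_csSup (h.bddAbove_weight_image fun x hx => hx.1) ?_ (image_mono fun x hx =>
    ((mem_avoiding_succ h.lasotaYorke.mapsTo).1 hx).1)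
  exact (nonempty_of_measure_ne_zero (h.volume_avoiding_ne_zero (m + 1))).image _

/-- Once the cylinders are short enough, the cylinder partition is adequate. -/
theorem isAdequate_cylinderPartition (h : IsFullBranched T Z H) {ε : ℝ} (hε : 0 < ε)
    {p : ℕ → ℕ} (hp : IsDescription T Z H ε p) :
    IsAdequate T Z (enlargedHole T H ((p 1 + 1) * p (p 2 + 3))) ε
      (cylinderPartition T Z H ((p 1 + 1) * p (p 2 + 3))) := by
  set m := (p 1 + 1) * p (p 2 + 3) with hm
  have hP := h.isIntervalPartition_cylinderPartition m
  obtain ⟨hMpos, hMle⟩ := h.inv_le_invDerivNorm hp.derivBound m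
  -- The modulus is used at level `p 2` because `2^{-p 2} ≤ 1 / p 2`, a lower bound for the norm.
  -- Strictness comes from the positivity of `ε` and of the norm.
  have hsmall : (1 / 2 : ℝ) ^ p 2 < invDerivNorm T Z (enlargedHole T H m) * (1 + ε) := by
    have h1 : (1 / 2 : ℝ) ^ p 2 ≤ (p 2 : ℝ)⁻¹ := by
      rw [one_div, inv_pow]
      exact inv_anti₀ (inv_pos.1 hMpos) (mod_cast Nat.lt_two_pow_self.le)
    nlinarith
  refine ⟨hP, fun B hB => ?_, fun B hB => ?_⟩
  · rw [domain_enlargedHole]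
    exact (h.disjoint_avoiding_or_subset hB).imp (fun hd => hd.mono_left interior_subset)
      interior_subset.trans
  · refine lt_of_le_of_lt ?_ ((ENNReal.ofReal_lt_ofReal_iff_of_nonneg (by positivity)).2 hsmall)
    rw [domain_enlargedHole]
    rcases h.disjoint_avoiding_or_subset hB with hd | hs
    · rw [eVariationOn.constant_on]
      · exact zero_le
      · rintro _ ⟨x, hx, rfl⟩ _ ⟨y, hy, rfl⟩
        rw [indicator_of_notMem (disjoint_left.1 hd hx), indicator_of_notMem (disjoint_left.1 hd hy)]
    · rw [eVariationOn.congr fun x hx => indicator_of_mem (hs hx) (weight T Z)]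
      obtain ⟨A, hA, hBA⟩ := h.exists_full_superset hB hs
      refine eVariationOn_le_of_forall_Icc fun a ha b hb hab =>
        hp.modulus (p 2) A hA a (hBA ha) b (hBA hb) hab ?_
      have hθ0 : (0 : ℝ) ≤ 1 - 1 / ((p 1 : ℝ) + 1) :=
        (weight_nonneg a).trans (hp.contraction A hA a (hBA ha))
      have hθ1 : 1 - 1 / ((p 1 : ℝ) + 1) ≤ 1 := sub_le_self _ (by positivity)
      -- With `θ = 1 - 1 / (p 1 + 1)`, the length is at most `θ^{m+1} ≤ θ^m ≤ 2^{-p (p 2 + 3)}`.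
      exact (le_abs_self _).trans ((h.cylinder_length_le hp.contraction hB hs a ha b hb).trans
        ((pow_le_pow_of_le_one hθ0 hθ1 m.le_succ).trans (one_sub_inv_pow_le_half _ _)))

theorem xi_eq_zero (h : IsFullBranched T Z H) {ε : ℝ} {m : ℕ}
    (hP : IsAdequate T Z (enlargedHole T H m) ε (cylinderPartition T Z H m)) :
    xi T Z (enlargedHole T H m) ε = 0 := by
  refine le_antisymm ((iInf₂_le _ hP).trans (iSup₂_le fun S hS => ?_)) bot_le
  have : S = ∅ := Finset.eq_empty_of_forall_notMem fun A hA =>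
    (Set.ext_iff.1 (h.badElements_cylinderPartition m) A).1 (hS.1 A hA)
  simp [this]

/-- At time zero the denominator is one, and the points outside the hole are exactly those in full
branches. Monotonicity of the ratios then bounds the escape rate below. -/
theorem infRatio_zero_eq_rhoBound (h : IsFullBranched T Z H) :
    infRatio T Z H 0 (transferIter T Z H 1 1) = rhoBound T Z H := by
  have hs : supportSet T Z H 0 = Icc 0 1 := by
    ext x
    simp [supportSet, transferIter]
  rw [infRatio, rhoBound, hs]
  congr 1
  ext x
  show transfer T Z H 1 x / (1 : ℝ) = _
  rw [div_one]
  show (∑ᶠ y ∈ {y | y ∈ Icc (0 : ℝ) 1 ∧ T y = x}, (domain H).indicator 1 y * weight T Z y) = _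
  rw [finsum_mem_def, finsum_mem_def]
  refine finsum_congr fun y => ?_
  by_cases hy : y ∈ domain H
  · have : (y ∈ {y | y ∈ Icc (0 : ℝ) 1 ∧ T y = x}) ↔
        y ∈ {y | (∃ A ∈ fullBranches T Z H, y ∈ A) ∧ T y = x} :=
      and_congr_left' ⟨fun _ => h.exists_full_of_mem_domain hy, fun _ => hy.1⟩
    by_cases hyx : y ∈ {y | y ∈ Icc (0 : ℝ) 1 ∧ T y = x}
    · rw [indicator_of_mem hyx, indicator_of_mem (this.1 hyx), indicator_of_mem hy, Pi.one_apply,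
        one_mul]
    · rw [indicator_of_notMem hyx, indicator_of_notMem fun hyx' => hyx (this.2 hyx')]
  · have hn : y ∉ {y | (∃ A ∈ fullBranches T Z H, y ∈ A) ∧ T y = x} :=
      fun ⟨⟨A, hA, hyA⟩, _⟩ => hy (h.full_subset_domain hA hyA)
    rw [indicator_of_notMem hn]
    refine indicator_apply_eq_zero.2 fun _ => ?_
    rw [indicator_of_notMem hy, zero_mul]

theorem exists_isEscapeRate (h : IsFullBranched T Z H) :
    ∃ ρ, IsEscapeRate T Z H ρ ∧ rhoBound T Z H ≤ ρ := by
  obtain ⟨ρ, hρ, hle⟩ := h.lasotaYorke.exists_tendsto_infRatio h.hasNonnullSupports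
    (h.lasotaYorke.transfer_one_nonneg H) (h.lasotaYorke.transfer_one_ae_le H)
  simp only [← transferIter_succ'] at hρ hle
  exact ⟨ρ, hρ, h.infRatio_zero_eq_rhoBound ▸ hle 0⟩

theorem alpha_le_alphaBound (h : IsFullBranched T Z H) {ε : ℝ} (hε : 0 < ε) {m : ℕ}
    (hξ : xi T Z (enlargedHole T H m) ε = 0) :
    alpha T Z (enlargedHole T H m) ε ≤ ENNReal.ofReal (alphaBound T Z H ε) := by
  have h2 : (2 : ENNReal) + ENNReal.ofReal ε = ENNReal.ofReal (2 + ε) := by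
    rw [ENNReal.ofReal_add two_pos.le hε.le, ENNReal.ofReal_ofNat]
  rw [alpha, hξ, ENat.toENNReal_zero, add_zero, h2, ← ENNReal.ofReal_mul' (by positivity)]
  exact ENNReal.ofReal_le_ofReal
    (mul_le_mul_of_nonneg_right (h.invDerivNorm_enlargedHole_le m) (by positivity))

theorem alphaBound_nonneg {ε : ℝ} (hε : 0 < ε) : 0 ≤ alphaBound T Z H ε :=
  mul_nonneg (Real.sSup_nonneg (forall_mem_image.2 fun _ _ => weight_nonneg _)) (by positivity)

end IsFullBranched

end OpenLY

theorem lemma4p3 :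
    -- one algorithm for all systems
    ∃ Φ : List ℕ → Option ℕ, Computable Φ ∧
      ∀ (T : ℝ → ℝ) (Z : Finset (Set ℝ)) (H : Set ℝ), OpenLY.IsFullBranched T Z H →
      ∀ ε : ℝ, 0 < ε →
        (∃ p : ℕ → ℕ, OpenLY.IsDescription T Z H ε p) ∧
        ∀ p : ℕ → ℕ, OpenLY.IsDescription T Z H ε p →
          ∃ m : ℕ, OpenLY.Outputs Φ p m ∧
            OpenLY.xi T Z (OpenLY.enlargedHole T H m) ε = 0 ∧
            (∃ ρ : ℝ, OpenLY.IsEscapeRate T Z H ρ ∧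
              OpenLY.IsEscapeRate T Z (OpenLY.enlargedHole T H m) ρ ∧
              OpenLY.rhoBound T Z H ≤ ρ) ∧
            OpenLY.alpha T Z (OpenLY.enlargedHole T H m) ε ≤
              ENNReal.ofReal (OpenLY.alphaBound T Z H ε) ∧
            (OpenLY.alphaBound T Z H ε < OpenLY.rhoBound T Z H →
              OpenLY.IsUlamAdmissible T Z (OpenLY.enlargedHole T H m) ε) := by
  refine ⟨OpenLY.iterationCount, OpenLY.computable_iterationCount, fun T Z H h ε hε =>
    ⟨h.exists_isDescription hε, fun p hp => ?_⟩⟩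
  have hξ := h.xi_eq_zero (h.isAdequate_cylinderPartition hε hp)
  obtain ⟨ρ, hρ, hle⟩ := h.exists_isEscapeRate
  have hρm := h.lasotaYorke.isEscapeRate_enlargedHole h.hasNonnullSupports
    (h.hasNonnullSupports_enlargedHole ((p 1 + 1) * p (p 2 + 3))) hρ
  have hα := h.alpha_le_alphaBound hε hξ
  refine ⟨_, OpenLY.outputs_iterationCount p, hξ, ⟨ρ, hρ, hρm, hle⟩, hα, fun hlt =>
    ⟨h.volume_supportInfty_ne_zero _, ρ, hρm, hα.trans_lt ?_⟩⟩
  exact (ENNReal.ofReal_lt_ofReal_iff_of_nonneg (OpenLY.IsFullBranched.alphaBound_nonneg hε)).2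
    (hlt.trans_le hle)
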